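/- **Proposition (Unadjusted HMC).** Let $d\ge 1$, $0<\alpha\le\beta$, $\kappa=\beta/\alpha$, and let $B\in\mathbb R^{d\times d}$ be a symmetric matrix with $\alpha I\preceq B\preceq \beta I$. Put $f(x)=\tfrac12 x^\top Bx$ and let $\pi$ be the probability measure on $\mathbb R^d$ with density proportional to $e^{-f(x)}$. For $\delta>0$, a leapfrog step of size $\delta$ maps $(x,v)\in\mathbb R^d\times\mathbb R^d$ to $(x',v')$, where $$v_{1/2}=v-\tfrac{\delta}{2}\nabla f(x),\qquad x'=x+\delta v_{1/2},\qquad v'=v_{1/2}-\tfrac{\delta}{2}\nabla f(x').$$ Let $\mathcal T=\{k\delta : k\in\mathbb Z_{\ge 0},\ k\delta<10\pi/\sqrt\alpha\}$ (here $\pi$ is the number). Let $\hat Q$ be the Markov kernel of unadjusted leapfrog HMC with random integration times: from $x$, draw independently $v\sim\mathcal N(0,I_d)$ and $t$ uniformly from $\mathcal T$, apply $t/\delta$ leapfrog steps to $(x,v)$, and output the resulting position. Write $\hat Q^K_x$ for the distribution after $K$ transitions started from $x$, and $\|\mu-\nu\|_{\mathrm{TV}}=\sup_A|\mu(A)-\nu(A)|$.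 There exist absolute constants $C>0$, $0<C'\le 1$ and $C''>0$ such that the following holds for all $d,\alpha,\beta,B$ as above, all $\varepsilon>0$, $x\in\mathbb R^d$, $K\in\mathbb Z_{\ge0}$ and $\delta>0$. If $$K\ \ge\ C\log\left(\frac{d\kappa(\sqrt\alpha\,\|x\|_\infty+1)}{\varepsilon}\right)\qquad\text{and}\qquad \delta\ \le\ C'\,\frac{\sqrt\varepsilon}{\sqrt\beta\,d^{1/4}},$$ then $$\|\hat Q^K_x-\pi\|_{\mathrm{TV}}\le\varepsilon .$$ Moreover, executing the $K$ transitions, with access to $f$ only through evaluations of $\nabla f$ (two per leapfrog step), returns a sample from $\hat Q^K_x$, and if $\delta\ge c\,\sqrt\varepsilon/(\sqrt\beta\,d^{1/4})$ for some $c>0$ (for instance $c=C'$, with $\delta$ the largest allowed step size), then it almost surely uses at most $$\frac{C''}{c}\cdot\frac{\sqrt\kappa\,d^{1/4}K}{\sqrt\varepsilon}$$ gradient evaluations. -/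

import Mathlib

open MeasureTheory ProbabilityTheory

noncomputable section

namespace UnadjustedHMC

/-- The space `ℝ^d` with its Euclidean structure. -/
abbrev Vec (d : ℕ) : Type := EuclideanSpace ℝ (Fin d)

/-- The potential `f(x) = ½ xᵀ B x`. -/
def potential {d : ℕ} (B : Matrix (Fin d) (Fin d) ℝ) (x : Vec d) : ℝ :=
  (1 / 2) * (x.ofLp ⬝ᵥ (B.mulVec x.ofLp))

/-- The target measure with Lebesgue density `exp(-f(x)) / ∫ exp(-f)`, where `f(x) = ½ xᵀ B x`;
for positive definite `B` it is the centred Gaussian with precision matrix `B`. -/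
def target {d : ℕ} (B : Matrix (Fin d) (Fin d) ℝ) : Measure (Vec d) :=
  (volume : Measure (Vec d)).tilted (fun x => -potential B x)

/-- The sup norm `‖x‖_∞ = max_i |x_i|`. -/
def supNorm {d : ℕ} (x : Vec d) : ℝ := ‖x.ofLp‖

/-- Total variation distance `sup_A |μ(A) - ν(A)|` over measurable sets `A`
(used for probability measures only). -/
def tvDist {Ω : Type*} [MeasurableSpace Ω] (μ ν : Measure Ω) : ℝ :=
  ⨆ A : {A : Set Ω // MeasurableSet A}, |μ.real A.1 - ν.real A.1|

/-- One step of size `δ` of the leapfrog (Störmer-Verlet) integrator for the Hamiltonian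
`H(x, v) = f(x) + ½ ‖v‖²`, where `g = ∇f`:
half a momentum update, a full position update, half a momentum update. -/
def leapfrogStep {d : ℕ} (g : Vec d → Vec d) (δ : ℝ) (z : Vec d × Vec d) : Vec d × Vec d :=
  let vHalf := z.2 - (δ / 2) • g z.1
  let x' := z.1 + δ • vHalf
  (x', vHalf - (δ / 2) • g x')

/-- `k` leapfrog steps of size `δ`, that is, integration time `t = k δ`. -/
def leapfrog {d : ℕ} (g : Vec d → Vec d) (δ : ℝ) (k : ℕ) (z : Vec d × Vec d) : Vec d × Vec d :=
  (leapfrogStep g δ)^[k] z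

/-- The admissible numbers of leapfrog steps: `k` is in this set iff `k δ` belongs to the set
`{k δ | k ∈ ℕ, k δ < 10 π / √α}` of integration times. -/
def stepCounts (α δ : ℝ) : Set ℕ := {k : ℕ | (k : ℝ) * δ < 10 * Real.pi / √α}

/-- The random draws of one transition: a momentum `v ∼ N(0, I_d)` and, independently,
an integration time `t = k δ` uniform on the admissible times, recorded through `k`. -/
def drawLaw (d : ℕ) (α δ : ℝ) : Measure (Vec d × ℕ) :=
  (stdGaussian (Vec d)).prod (uniformOn (stepCounts α δ))

/-- The Markov kernel of unadjusted leapfrog HMC with random integration time: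
from `x`, draw `(v, k)`, run `k` leapfrog steps from `(x, v)` and keep the position. -/
def hmcKernel {d : ℕ} (B : Matrix (Fin d) (Fin d) ℝ) (α δ : ℝ) : Kernel (Vec d) (Vec d) :=
  (Kernel.id ×ₖ Kernel.const (Vec d) (drawLaw d α δ)).map
    (fun p => (leapfrog (gradient (potential B)) δ p.2.2 (p.1, p.2.1)).1)

/-- Programs that may query an oracle `E → E` (here: the gradient of the potential)
and finally return a value of type `R`. -/
inductive OracleProg (E R : Type) : Type where
  /-- stop and return a value -/
  | ret (r : R) : OracleProg E R
  /-- query the oracle at `x` and continue with its answer -/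
  | query (x : E) (cont : E → OracleProg E R) : OracleProg E R

namespace OracleProg

/-- Sequential composition. -/
def andThen {E R S : Type} : OracleProg E R → (R → OracleProg E S) → OracleProg E S
  | ret r, h => h r
  | query x cont, h => query x (fun a => (cont a).andThen h)

/-- The value returned when queries are answered by `g`. -/
def output {E R : Type} (g : E → E) : OracleProg E R → R
  | ret r => r
  | query x cont => (cont (g x)).output g

/-- The number of queries made when queries are answered by `g`. -/
def queries {E R : Type} (g : E → E) : OracleProg E R → ℕ
  | ret _ => 0
  | query x cont => (cont (g x)).queries g + 1

end OracleProg

/-- A leapfrog step as a program that queries the gradient. -/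
def leapfrogStepProg {d : ℕ} (δ : ℝ) (z : Vec d × Vec d) : OracleProg (Vec d) (Vec d × Vec d) :=
  .query z.1 fun a =>
    let vHalf := z.2 - (δ / 2) • a
    let x' := z.1 + δ • vHalf
    .query x' fun b => .ret (x', vHalf - (δ / 2) • b)

/-- `k` leapfrog steps as a program. -/
def leapfrogProg {d : ℕ} (δ : ℝ) : ℕ → Vec d × Vec d → OracleProg (Vec d) (Vec d × Vec d)
  | 0, z => .ret z
  | k + 1, z => (leapfrogStepProg δ z).andThen (leapfrogProg δ k)

/-- One HMC transition from `x` with random draws `ξ = (v, k)`, as a program. -/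
def hmcStepProg {d : ℕ} (δ : ℝ) (ξ : Vec d × ℕ) (x : Vec d) : OracleProg (Vec d) (Vec d) :=
  (leapfrogProg δ ξ.2 (x, ξ.1)).andThen fun z => .ret z.1

/-- `K` HMC transitions started from `x` with random draws `ξ 0, …, ξ (K - 1)`, as a program.
The potential enters only through the answers to the gradient queries. -/
def hmcProg {d : ℕ} (δ : ℝ) : (K : ℕ) → (Fin K → Vec d × ℕ) → Vec d → OracleProg (Vec d) (Vec d)
  | 0, _, x => .ret x
  | K + 1, ξ, x => (hmcProg δ K (Fin.init ξ) x).andThen (hmcStepProg δ (ξ (Fin.last K)))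

/-- The joint law of the random draws of `K` transitions (independent copies). -/
def drawsLaw (d : ℕ) (α δ : ℝ) (K : ℕ) : Measure (Fin K → Vec d × ℕ) :=
  Measure.pi fun _ => drawLaw d α δ

end UnadjustedHMC

end

open UnadjustedHMC

noncomputable section

namespace UnadjustedHMC

/-! ### The program -/

namespace OracleProg

/-! In an eigenbasis of `B` the leapfrog map decouples into rotations (`repr_leapfrog`): for
eigenvalue `λ` and `cos θ = 1 - δ²λ/2`, `k` steps send `x` to `cos(kθ) x + (δ / sin θ) sin(kθ) v`.
Hence, given the integration times, the chain started at a point stays Gaussian with independent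
coordinates, of mean `R y` and variance `(1 - R²) τ`, where `R` is the product of the cosines drawn
so far and `τ = (δ / sin θ)² = 1 / (λ (1 - δ²λ/4))` is the stationary variance
(`bind_conditionalLaw`).

The law of the chain is a mixture of such Gaussians. By Jensen, the squared discrepancy on an event
is at most the average of the squared discrepancies of the components. Each of these is bounded
through the Hellinger affinity, which is explicit for Gaussians and tensorises
(`sq_basisGaussian_sub_le`), by `∑ (U_j + w_j R_j²)`. A transition multiplies `R_j²` by a squared
cosine whose average over the long range of times is at most `3/4` (`sum_cos_sq_arccos_le`), so
after `K` transitions the bound is `∑ (U_j + (3/4)^K w_j)` (`sq_bind_pow_sub_le`).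

The bias `U_j` is quadratic in the relative variance error `u = δ²λ/4`
(`one_sub_gaussianAffinitySq_le`). Thus `d (δ²β)² ≤ ε²` is what is needed, which explains the step
size `√ε / (√β d^(1/4))`. The term with `(3/4)^K` is absorbed by the logarithmic lower bound on `K`.

The remaining claims hold by construction: the program performs the same maps on the same draws, and
a transition has fewer than `10π / (√α δ)` steps of two queries each. -/

theorem output_andThen {E R S : Type} (g : E → E) (p : OracleProg E R)
    (h : R → OracleProg E S) : (p.andThen h).output g = (h (p.output g)).output g := by
  induction p with
  | ret r => rfl
  | query x cont ih => exact ih (g x)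

theorem queries_andThen {E R S : Type} (g : E → E) (p : OracleProg E R)
    (h : R → OracleProg E S) :
    (p.andThen h).queries g = p.queries g + (h (p.output g)).queries g := by
  induction p with
  | ret r => simp [andThen, queries, output]
  | query x cont ih =>
    simp only [andThen, queries, output, ih]
    omega

end OracleProg

theorem output_leapfrogProg {d : ℕ} (g : Vec d → Vec d) (δ : ℝ) (k : ℕ) (z : Vec d × Vec d) :
    (leapfrogProg δ k z).output g = leapfrog g δ k z := by
  induction k generalizing z with
  | zero => rfl
  | succ k ih =>
    rw [leapfrogProg, OracleProg.output_andThen, ih]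
    rfl

theorem queries_leapfrogProg {d : ℕ} (g : Vec d → Vec d) (δ : ℝ) (k : ℕ) (z : Vec d × Vec d) :
    (leapfrogProg δ k z).queries g = 2 * k := by
  induction k generalizing z with
  | zero => rfl
  | succ k ih =>
    rw [leapfrogProg, OracleProg.queries_andThen, ih]
    simp only [leapfrogStepProg, OracleProg.queries]
    omega

/-- The position after one transition, as a function of the state and the random draws. -/
def hmcStep {d : ℕ} (g : Vec d → Vec d) (δ : ℝ) (p : Vec d × (Vec d × ℕ)) : Vec d :=
  (leapfrog g δ p.2.2 (p.1, p.2.1)).1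

theorem output_hmcProg_succ {d : ℕ} (g : Vec d → Vec d) (δ : ℝ) (K : ℕ)
    (ξ : Fin (K + 1) → Vec d × ℕ) (x : Vec d) :
    (hmcProg δ (K + 1) ξ x).output g
      = hmcStep g δ ((hmcProg δ K (Fin.init ξ) x).output g, ξ (Fin.last K)) := by
  rw [hmcProg, OracleProg.output_andThen, hmcStepProg, OracleProg.output_andThen,
    output_leapfrogProg]
  rfl

theorem queries_hmcProg {d : ℕ} (g : Vec d → Vec d) (δ : ℝ) (K : ℕ)
    (ξ : Fin K → Vec d × ℕ) (x : Vec d) :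
    (hmcProg δ K ξ x).queries g = ∑ i, 2 * (ξ i).2 := by
  induction K with
  | zero => rfl
  | succ K ih =>
    rw [hmcProg, OracleProg.queries_andThen, ih, hmcStepProg, OracleProg.queries_andThen,
      queries_leapfrogProg, Fin.sum_univ_castSucc]
    rfl

/-! ### The law of the draws -/

/-- The strict inequality `k < r` for natural `k` is `k < ⌈r⌉₊`, so the admissible counts form an
initial segment. It contains `0`, hence is nonempty, which `uniformOn` requires in order to be a
probability measure. -/
theorem stepCounts_eq {α δ : ℝ} (hδ : 0 < δ) :
    stepCounts α δ = (Finset.range ⌈10 * Real.pi / √α / δ⌉₊ : Set ℕ) := by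
  ext k
  simp [stepCounts, Nat.lt_ceil, lt_div_iff₀ hδ]

theorem ceil_steps_pos {α δ : ℝ} (hα : 0 < α) (hδ : 0 < δ) :
    0 < ⌈10 * Real.pi / √α / δ⌉₊ := by
  have := Real.pi_pos
  rw [Nat.ceil_pos]
  positivity

theorem isProbabilityMeasure_uniformOn_stepCounts {α δ : ℝ} (hα : 0 < α) (hδ : 0 < δ) :
    IsProbabilityMeasure (uniformOn (stepCounts α δ)) := by
  rw [stepCounts_eq hδ]
  exact isProbabilityMeasure_uniformOn (Finset.finite_toSet _)
    ⟨0, by simpa using ceil_steps_pos hα hδ⟩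

theorem isProbabilityMeasure_drawLaw (d : ℕ) {α δ : ℝ} (hα : 0 < α) (hδ : 0 < δ) :
    IsProbabilityMeasure (drawLaw d α δ) := by
  have := isProbabilityMeasure_uniformOn_stepCounts hα hδ
  rw [drawLaw]
  infer_instance

theorem ae_drawLaw_mem_stepCounts (d : ℕ) {α δ : ℝ} (hα : 0 < α) (hδ : 0 < δ) :
    ∀ᵐ ξ ∂(drawLaw d α δ), ξ.2 ∈ stepCounts α δ := by
  have := isProbabilityMeasure_uniformOn_stepCounts hα hδ
  refine Measure.quasiMeasurePreserving_snd.ae (p := fun k => k ∈ stepCounts α δ) ?_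
  exact ae_cond_mem (MeasurableSet.of_discrete)

theorem ae_drawsLaw_mem_stepCounts (d : ℕ) {α δ : ℝ} (hα : 0 < α) (hδ : 0 < δ) (K : ℕ) :
    ∀ᵐ ξ ∂(drawsLaw d α δ K), ∀ i, (ξ i).2 ∈ stepCounts α δ := by
  have := isProbabilityMeasure_drawLaw d hα hδ
  rw [ae_all_iff]
  intro i
  exact (measurePreserving_eval (fun _ : Fin K => drawLaw d α δ) i).quasiMeasurePreserving.ae
    (p := fun ξ => ξ.2 ∈ stepCounts α δ) (ae_drawLaw_mem_stepCounts d hα hδ)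

/-! ### The kernel -/

theorem measurable_hmcStep {d : ℕ} {g : Vec d → Vec d} (hg : Measurable g) (δ : ℝ) :
    Measurable (hmcStep g δ) := by
  have h1 : Measurable (leapfrogStep g δ) := by
    unfold leapfrogStep
    fun_prop
  have h2 (k : ℕ) : Measurable (leapfrog g δ k) := h1.iterate k
  have h3 : Measurable (fun q : (Vec d × Vec d) × ℕ => (leapfrog g δ q.2 q.1).1) :=
    measurable_from_prod_countable_left fun k => (h2 k).fst
  exact h3.comp (((measurable_fst.prodMk (measurable_fst.comp measurable_snd))).prodMk
    (measurable_snd.comp measurable_snd))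

theorem gradient_potential {d : ℕ} {B : Matrix (Fin d) (Fin d) ℝ} (hB : B.IsHermitian) :
    gradient (potential B) = fun x => Matrix.toEuclideanCLM (𝕜 := ℝ) B x := by
  funext x
  have hT : (Matrix.toEuclideanCLM (𝕜 := ℝ) B : Vec d →ₗ[ℝ] Vec d).IsSymmetric :=
    Matrix.isSymmetric_toEuclideanLin_iff.2 hB
  have hp : potential B = fun x => (1 / 2 : ℝ) *
      (Matrix.toEuclideanCLM (𝕜 := ℝ) B).reApplyInnerSelf x := by
    funext y
    simp [potential, ContinuousLinearMap.reApplyInnerSelf_apply,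
      EuclideanSpace.inner_eq_star_dotProduct]
  refine HasGradientAt.gradient ?_
  rw [hasGradientAt_iff_hasFDerivAt, hp]
  convert! (hT.hasStrictFDerivAt_reApplyInnerSelf x).hasFDerivAt.const_mul (1 / 2 : ℝ) using 1
  ext y
  simp

theorem measurable_gradient_potential {d : ℕ} {B : Matrix (Fin d) (Fin d) ℝ}
    (hB : B.IsHermitian) : Measurable (gradient (potential B)) := by
  rw [gradient_potential hB]
  fun_prop

theorem bind_hmcKernel {d : ℕ} {B : Matrix (Fin d) (Fin d) ℝ} (hB : B.IsHermitian) {α δ : ℝ}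
    (hα : 0 < α) (hδ : 0 < δ) (μ : Measure (Vec d)) [SFinite μ] :
    μ.bind (hmcKernel B α δ)
      = (μ.prod (drawLaw d α δ)).map (hmcStep (gradient (potential B)) δ) := by
  have := isProbabilityMeasure_drawLaw d hα hδ
  have hm := measurable_hmcStep (measurable_gradient_potential hB) δ
  have : hmcKernel B α δ = (Kernel.id ×ₖ Kernel.const (Vec d) (drawLaw d α δ)).map
    (hmcStep (gradient (potential B)) δ) := rfl
  rw [this, ← Measure.map_comp _ _ hm, ← Measure.compProd_eq_comp_prod, Measure.compProd_const]

theorem pow_succ_hmcKernel_apply {d : ℕ} (B : Matrix (Fin d) (Fin d) ℝ) (α δ : ℝ) (K : ℕ)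
    (x : Vec d) :
    (hmcKernel B α δ ^ (K + 1)) x = ((hmcKernel B α δ ^ K) x).bind (hmcKernel B α δ) := by
  rw [pow_succ']
  rfl

theorem isMarkovKernel_hmcKernel {d : ℕ} {B : Matrix (Fin d) (Fin d) ℝ} (hB : B.IsHermitian)
    {α δ : ℝ} (hα : 0 < α) (hδ : 0 < δ) : IsMarkovKernel (hmcKernel B α δ) := by
  have := isProbabilityMeasure_drawLaw d hα hδ
  exact Kernel.IsMarkovKernel.map _
    (measurable_hmcStep (measurable_gradient_potential hB) δ)

theorem isMarkovKernel_pow {Ω : Type*} [MeasurableSpace Ω] (κ : Kernel Ω Ω) [IsMarkovKernel κ]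
    (K : ℕ) : IsMarkovKernel (κ ^ K) := by
  induction K with
  | zero =>
    rw [pow_zero]
    exact inferInstanceAs (IsMarkovKernel Kernel.id)
  | succ K ih =>
    rw [pow_succ]
    exact inferInstanceAs (IsMarkovKernel ((κ ^ K) ∘ₖ κ))

theorem measurable_output_hmcProg {d : ℕ} {g : Vec d → Vec d} (hg : Measurable g) (δ : ℝ) (K : ℕ)
    (x : Vec d) : Measurable fun ξ => (hmcProg δ K ξ x).output g := by
  induction K with
  | zero => exact measurable_const
  | succ K ih =>
    simp_rw [output_hmcProg_succ]
    have h : Measurable (fun ξ : Fin (K + 1) → Vec d × ℕ => (Fin.init ξ : Fin K → Vec d × ℕ)) :=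
      measurable_pi_lambda _ fun i => measurable_pi_apply _
    exact (measurable_hmcStep hg δ).comp ((ih.comp h).prodMk (measurable_pi_apply _))

theorem map_output_hmcProg {d : ℕ} {B : Matrix (Fin d) (Fin d) ℝ} (hB : B.IsHermitian) {α δ : ℝ}
    (hα : 0 < α) (hδ : 0 < δ) (K : ℕ) (x : Vec d) :
    (drawsLaw d α δ K).map (fun ξ => (hmcProg δ K ξ x).output (gradient (potential B)))
      = (hmcKernel B α δ ^ K) x := by
  have := isProbabilityMeasure_drawLaw d hα hδ
  have := isMarkovKernel_hmcKernel hB hα hδ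
  have hg := measurable_gradient_potential hB
  induction K with
  | zero =>
    have : IsProbabilityMeasure (drawsLaw d α δ 0) := by
      unfold drawsLaw
      infer_instance
    simp only [hmcProg, OracleProg.output, Measure.map_const, measure_univ, one_smul, pow_zero]
    exact (Kernel.id_apply x).symm
  | succ K ih =>
    have := isMarkovKernel_pow (hmcKernel B α δ) K
    have : IsProbabilityMeasure (drawsLaw d α δ K) := by
      unfold drawsLaw
      infer_instance
    have hK := measurable_output_hmcProg hg δ K x
    rw [pow_succ_hmcKernel_apply, bind_hmcKernel hB hα hδ, ← ih]
    -- The last draw is independent of the others, so it can be split off and fed to the kernel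
    -- after the first `K` transitions.
    have hp := (measurePreserving_piFinSuccAbove (fun _ : Fin (K + 1) => drawLaw d α δ)
      (Fin.last K)).map_eq
    have h2 : ((drawsLaw d α δ K).map
        (fun ξ => (hmcProg δ K ξ x).output (gradient (potential B)))).prod (drawLaw d α δ)
        = ((drawLaw d α δ).prod (drawsLaw d α δ K)).map
          (fun p => ((hmcProg δ K p.2 x).output (gradient (potential B)), p.1)) := by
      conv_lhs => rw [← Measure.map_id (μ := drawLaw d α δ)]
      rw [Measure.map_prod_map _ _ hK measurable_id, ← Measure.prod_swap,
        Measure.map_map (by fun_prop) (by fun_prop)]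
      rfl
    have hq : Measurable (fun p : (Vec d × ℕ) × (Fin K → Vec d × ℕ) =>
        ((hmcProg δ K p.2 x).output (gradient (potential B)), p.1)) :=
      (hK.comp measurable_snd).prodMk measurable_fst
    rw [h2, Measure.map_map (measurable_hmcStep hg δ) hq]
    unfold drawsLaw at hp ⊢
    rw [← hp, Measure.map_map ((measurable_hmcStep hg δ).comp hq)
      (MeasurableEquiv.measurable _)]
    congr 1
    funext ξ
    rw [output_hmcProg_succ]
    simp only [Function.comp, MeasurableEquiv.piFinSuccAbove_apply, Fin.insertNthEquiv_last,
      Fin.snocEquiv_symm_apply]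

/-- A transition draws at most `10π / (√α δ)` leapfrog steps, each with two queries. -/
theorem ae_queries_hmcProg_le {d : ℕ} (g : Vec d → Vec d) {α δ : ℝ} (hα : 0 < α) (hδ : 0 < δ)
    (K : ℕ) (x : Vec d) :
    ∀ᵐ ξ ∂(drawsLaw d α δ K), ((hmcProg δ K ξ x).queries g : ℝ)
      ≤ K * (2 * (10 * Real.pi / √α / δ)) := by
  filter_upwards [ae_drawsLaw_mem_stepCounts d hα hδ K] with ξ hξ
  rw [queries_hmcProg]
  push_cast
  calc ∑ i, 2 * ((ξ i).2 : ℝ) ≤ ∑ _i : Fin K, 2 * (10 * Real.pi / √α / δ) := by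
        gcongr with i
        exact ((lt_div_iff₀ hδ).2 (hξ i)).le
    _ = _ := by simp


/-! ### Total variation and Hellinger affinity -/

theorem integral_sqrt_mul_le {Ω : Type*} [MeasurableSpace Ω] {μ : Measure Ω} {p q : Ω → ℝ}
    (hp : Integrable p μ) (hq : Integrable q μ) (hp0 : ∀ x, 0 ≤ p x) (hq0 : ∀ x, 0 ≤ q x) :
    ∫ x, √(p x * q x) ∂μ ≤ √(∫ x, p x ∂μ) * √(∫ x, q x ∂μ) := by
  have hL {f : Ω → ℝ} (hf : Integrable f μ) (hf0 : ∀ x, 0 ≤ f x) :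
      MemLp (fun x => √(f x)) (ENNReal.ofReal 2) μ := by
    rw [ENNReal.ofReal_ofNat, memLp_two_iff_integrable_sq
      (Real.continuous_sqrt.comp_aestronglyMeasurable hf.1)]
    simpa only [Real.sq_sqrt (hf0 _)] using hf
  have h := integral_mul_le_Lp_mul_Lq_of_nonneg (μ := μ) Real.HolderConjugate.two_two
    (ae_of_all _ fun x => Real.sqrt_nonneg (p x)) (ae_of_all _ fun x => Real.sqrt_nonneg (q x))
    (hL hp hp0) (hL hq hq0)
  simpa only [Real.sqrt_mul (hp0 _), Real.rpow_two, Real.sq_sqrt (hp0 _), Real.sq_sqrt (hq0 _),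
    ← Real.sqrt_eq_rpow] using h

theorem integrable_sqrt_mul {Ω : Type*} [MeasurableSpace Ω] {μ : Measure Ω} {p q : Ω → ℝ}
    (hp : Integrable p μ) (hq : Integrable q μ) (hp0 : ∀ x, 0 ≤ p x) (hq0 : ∀ x, 0 ≤ q x) :
    Integrable (fun x => √(p x * q x)) μ := by
  refine (hp.add hq).mono'
    (Real.continuous_sqrt.comp_aestronglyMeasurable (hp.1.mul hq.1)) (ae_of_all _ fun x => ?_)
  rw [Real.norm_of_nonneg (Real.sqrt_nonneg _)]
  refine Real.sqrt_le_iff.2 ⟨add_nonneg (hp0 x) (hq0 x), ?_⟩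
  simp only [Pi.add_apply]
  nlinarith [hp0 x, hq0 x, mul_nonneg (hp0 x) (hq0 x)]

/-- This is the two-point case of the Hellinger bound. With `√a = cos φ` and `√b = cos ψ`, the right
side of `hρ` is `cos(φ - ψ)`, while `a - b = -sin(φ - ψ) sin(φ + ψ)`. -/
theorem sq_sub_le_one_sub_sq {a b ρ : ℝ} (ha : 0 ≤ a) (ha1 : a ≤ 1) (hb : 0 ≤ b) (hb1 : b ≤ 1)
    (hρ0 : 0 ≤ ρ) (hρ : ρ ≤ √a * √b + √(1 - a) * √(1 - b)) : (a - b) ^ 2 ≤ 1 - ρ ^ 2 := by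
  have h1 := Real.sq_sqrt ha
  have h2 := Real.sq_sqrt hb
  have h3 := Real.sq_sqrt (sub_nonneg.2 ha1)
  have h4 := Real.sq_sqrt (sub_nonneg.2 hb1)
  generalize √a = x at *
  generalize √b = y at *
  generalize √(1 - a) = z at *
  generalize √(1 - b) = w at *
  have h5 : ρ ^ 2 ≤ (x * y + z * w) ^ 2 := by gcongr
  have hz : z ^ 2 = 1 - x ^ 2 := by linarith
  have hw : w ^ 2 = 1 - y ^ 2 := by linarith
  have h6 : (x * y + z * w) ^ 2 + (x * w - z * y) ^ 2 = 1 := by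
    have : (x * y + z * w) ^ 2 + (x * w - z * y) ^ 2 = (x ^ 2 + z ^ 2) * (y ^ 2 + w ^ 2) := by ring
    rw [this, hz, hw]
    ring
  have h7 : (x * w + z * y) ^ 2 + (x * y - z * w) ^ 2 = 1 := by
    have : (x * w + z * y) ^ 2 + (x * y - z * w) ^ 2 = (x ^ 2 + z ^ 2) * (y ^ 2 + w ^ 2) := by ring
    rw [this, hz, hw]
    ring
  have h8 : a - b = (x * w - z * y) * (x * w + z * y) := by
    have : (x * w - z * y) * (x * w + z * y) = x ^ 2 * w ^ 2 - z ^ 2 * y ^ 2 := by ring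
    rw [this, hz, hw, ← h1, ← h2]
    ring
  rw [h8, mul_pow]
  have h9 : (x * w + z * y) ^ 2 ≤ 1 := by linarith [sq_nonneg (x * y - z * w)]
  nlinarith [sq_nonneg (x * w - z * y)]

/-- The total variation distance is bounded through the Hellinger affinity `∫ √(p q)`. -/
theorem sq_setIntegral_sub_le {Ω : Type*} [MeasurableSpace Ω] {μ : Measure Ω} {p q : Ω → ℝ}
    (hp : Integrable p μ) (hq : Integrable q μ) (hp0 : ∀ x, 0 ≤ p x) (hq0 : ∀ x, 0 ≤ q x)
    (hp1 : ∫ x, p x ∂μ = 1) (hq1 : ∫ x, q x ∂μ = 1) {A : Set Ω} (hA : MeasurableSet A) :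
    (∫ x in A, p x ∂μ - ∫ x in A, q x ∂μ) ^ 2 ≤ 1 - (∫ x, √(p x * q x) ∂μ) ^ 2 := by
  have hpA := integral_add_compl hA hp
  have hqA := integral_add_compl hA hq
  have hpc : 0 ≤ ∫ x in Aᶜ, p x ∂μ := integral_nonneg hp0
  have hqc : 0 ≤ ∫ x in Aᶜ, q x ∂μ := integral_nonneg hq0
  refine sq_sub_le_one_sub_sq (integral_nonneg hp0) (by linarith) (integral_nonneg hq0)
    (by linarith) (integral_nonneg fun _ => Real.sqrt_nonneg _) ?_
  -- Cauchy–Schwarz on `A` and on its complement separately bounds the affinity by that of the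
  -- two-point distributions `(p(A), p(Aᶜ))` and `(q(A), q(Aᶜ))`.
  rw [← integral_add_compl hA (integrable_sqrt_mul hp hq hp0 hq0),
    show 1 - ∫ x in A, p x ∂μ = ∫ x in Aᶜ, p x ∂μ by linarith,
    show 1 - ∫ x in A, q x ∂μ = ∫ x in Aᶜ, q x ∂μ by linarith]
  exact add_le_add (integral_sqrt_mul_le hp.restrict hq.restrict hp0 hq0)
    (integral_sqrt_mul_le hp.restrict hq.restrict hp0 hq0)

theorem one_sub_prod_le_sum {ι : Type*} (s : Finset ι) {a : ι → ℝ} (h0 : ∀ i, 0 ≤ a i)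
    (h1 : ∀ i, a i ≤ 1) : 1 - ∏ i ∈ s, a i ≤ ∑ i ∈ s, (1 - a i) := by
  classical
  induction s using Finset.induction_on with
  | empty => simp
  | insert i s hi ih =>
    rw [Finset.prod_insert hi, Finset.sum_insert hi]
    have h2 : ∏ j ∈ s, a j ≤ 1 := Finset.prod_le_one (fun j _ => h0 j) (fun j _ => h1 j)
    nlinarith [h0 i, h1 i]

/-! ### Products of real Gaussian measures -/

theorem pi_gaussianReal_eq_withDensity {ι : Type*} [Fintype ι] (m : ι → ℝ) {s : ι → NNReal}
    (hs : ∀ i, s i ≠ 0) :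
    Measure.pi (fun i => gaussianReal (m i) (s i))
      = (volume : Measure (ι → ℝ)).withDensity
          (fun x => ENNReal.ofReal (∏ i, gaussianPDFReal (m i) (s i) (x i))) := by
  refine Measure.pi_eq fun A hA => ?_
  have h0 (i : ι) (x : ℝ) := gaussianPDFReal_nonneg (m i) (s i) x
  rw [withDensity_apply _ (MeasurableSet.univ_pi hA), volume_pi, Measure.restrict_pi_pi,
    ← ofReal_integral_eq_lintegral_ofReal
      (Integrable.fintype_prod fun i => (integrable_gaussianPDFReal (m i) (s i)).restrict)
      (ae_of_all _ fun x => Finset.prod_nonneg fun i _ => h0 i (x i)),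
    integral_fintype_prod_eq_prod, ENNReal.ofReal_prod_of_nonneg
      (fun i _ => integral_nonneg (h0 i))]
  refine Finset.prod_congr rfl fun i _ => ?_
  rw [gaussianReal_of_var_ne_zero _ (hs i), withDensity_apply _ (hA i)]
  exact ofReal_integral_eq_lintegral_ofReal (integrable_gaussianPDFReal (m i) (s i)).restrict
    (ae_of_all _ (h0 i))

theorem integral_prod_gaussianPDFReal {ι : Type*} [Fintype ι] (m : ι → ℝ) {s : ι → NNReal}
    (hs : ∀ i, s i ≠ 0) : ∫ x : ι → ℝ, ∏ i, gaussianPDFReal (m i) (s i) (x i) = 1 := by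
  rw [integral_fintype_prod_volume_eq_prod (fun i => gaussianPDFReal (m i) (s i))]
  exact Finset.prod_eq_one fun i _ => integral_gaussianPDFReal_eq_one (m i) (hs i)

theorem pi_gaussianReal_real {ι : Type*} [Fintype ι] (m : ι → ℝ) {s : ι → NNReal}
    (hs : ∀ i, s i ≠ 0) {A : Set (ι → ℝ)} (hA : MeasurableSet A) :
    (Measure.pi (fun i => gaussianReal (m i) (s i))).real A
      = ∫ x in A, ∏ i, gaussianPDFReal (m i) (s i) (x i) := by
  have h0 (x : ι → ℝ) : 0 ≤ ∏ i, gaussianPDFReal (m i) (s i) (x i) :=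
    Finset.prod_nonneg fun i _ => gaussianPDFReal_nonneg (m i) (s i) (x i)
  have hi : Integrable (fun x : ι → ℝ => ∏ i, gaussianPDFReal (m i) (s i) (x i)) :=
    Integrable.fintype_prod fun i => integrable_gaussianPDFReal (m i) (s i)
  rw [Measure.real, pi_gaussianReal_eq_withDensity m hs, withDensity_apply _ hA,
    ← ofReal_integral_eq_lintegral_ofReal hi.restrict (ae_of_all _ h0),
    ENNReal.toReal_ofReal (integral_nonneg h0)]

/-- The squared Hellinger affinity of `N(m, s)` and `N(0, t)`. -/
def gaussianAffinitySq (m s t : ℝ) : ℝ :=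
  2 * √(s * t) / (s + t) * Real.exp (-(m ^ 2 / (2 * (s + t))))

theorem gaussianAffinitySq_nonneg (m : ℝ) {s t : ℝ} (hs : 0 ≤ s) (ht : 0 ≤ t) :
    0 ≤ gaussianAffinitySq m s t := by
  unfold gaussianAffinitySq
  positivity

theorem gaussianAffinitySq_le_one (m : ℝ) {s t : ℝ} (hs : 0 < s) (ht : 0 < t) :
    gaussianAffinitySq m s t ≤ 1 := by
  have h1 : 2 * √(s * t) / (s + t) ≤ 1 := by
    rw [div_le_one (by positivity), Real.sqrt_mul hs.le]
    nlinarith [sq_nonneg (√s - √t), Real.sq_sqrt hs.le, Real.sq_sqrt ht.le]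
  have h2 : Real.exp (-(m ^ 2 / (2 * (s + t)))) ≤ 1 := by
    rw [Real.exp_le_one_iff, neg_nonpos]
    positivity
  exact mul_le_one₀ h1 (Real.exp_pos _).le h2

/-- Completing the square makes the product of the two densities a constant times the square of a
Gaussian function centred at `m t / (s + t)`. -/
theorem sq_integral_sqrt_gaussianPDFReal_mul (m : ℝ) {s t : NNReal} (hs : s ≠ 0) (ht : t ≠ 0) :
    (∫ x, √(gaussianPDFReal m s x * gaussianPDFReal 0 t x)) ^ 2 = gaussianAffinitySq m s t := by
  have hs' : (0 : ℝ) < s := by positivity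
  have ht' : (0 : ℝ) < t := by positivity
  have hpi := Real.pi_pos
  generalize hsr : (s : ℝ) = σ at *
  generalize htr : (t : ℝ) = τ at *
  have key (x : ℝ) : √(gaussianPDFReal m s x * gaussianPDFReal 0 t x)
      = √((√(2 * Real.pi * σ))⁻¹ * (√(2 * Real.pi * τ))⁻¹)
          * Real.exp (-(m ^ 2 / (4 * (σ + τ))))
          * Real.exp (-((σ + τ) / (4 * σ * τ)) * (x - m * τ / (σ + τ)) ^ 2) := by
    have : gaussianPDFReal m s x * gaussianPDFReal 0 t x
        = ((√(2 * Real.pi * σ))⁻¹ * (√(2 * Real.pi * τ))⁻¹)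
          * (Real.exp (-(m ^ 2 / (4 * (σ + τ))))
            * Real.exp (-((σ + τ) / (4 * σ * τ)) * (x - m * τ / (σ + τ)) ^ 2)) ^ 2 := by
      rw [gaussianPDFReal, gaussianPDFReal, hsr, htr, mul_mul_mul_comm, ← Real.exp_add,
        ← Real.exp_add, ← Real.exp_nat_mul]
      congr 2
      field_simp
      ring
    rw [this, Real.sqrt_mul (by positivity), Real.sqrt_sq (by positivity)]
    exact (mul_assoc _ _ _).symm
  simp_rw [key]
  rw [integral_const_mul, integral_sub_right_eq_self
    (fun x => Real.exp (-((σ + τ) / (4 * σ * τ)) * x ^ 2)), integral_gaussian, mul_pow, mul_pow,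
    Real.sq_sqrt (by positivity), Real.sq_sqrt (by positivity), ← Real.exp_nat_mul,
    ← mul_inv, ← Real.sqrt_mul (by positivity),
    show 2 * Real.pi * σ * (2 * Real.pi * τ) = (2 * Real.pi) ^ 2 * (σ * τ) by ring,
    Real.sqrt_mul (by positivity), Real.sqrt_sq (by positivity), gaussianAffinitySq,
    show ((2 : ℕ) : ℝ) * -(m ^ 2 / (4 * (σ + τ))) = -(m ^ 2 / (2 * (σ + τ))) by
      push_cast
      field_simp
      ring]
  have hq : √(σ * τ) ^ 2 = σ * τ := Real.sq_sqrt (by positivity)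
  have hq0 : 0 < √(σ * τ) := by positivity
  field_simp
  rw [hq]
  ring

/-- Affinities of product measures multiply, and one minus a product of numbers in `[0, 1]` is at
most the sum of the defects. -/
theorem sq_pi_gaussianReal_sub_le {ι : Type*} [Fintype ι] (m : ι → ℝ) {s t : ι → NNReal}
    (hs : ∀ i, s i ≠ 0) (ht : ∀ i, t i ≠ 0) {A : Set (ι → ℝ)} (hA : MeasurableSet A) :
    ((Measure.pi (fun i => gaussianReal (m i) (s i))).real A
        - (Measure.pi (fun i => gaussianReal 0 (t i))).real A) ^ 2
      ≤ ∑ i, (1 - gaussianAffinitySq (m i) (s i) (t i)) := by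
  have hp0 {m : ι → ℝ} {s : ι → NNReal} (x : ι → ℝ) :
      0 ≤ ∏ i, gaussianPDFReal (m i) (s i) (x i) :=
    Finset.prod_nonneg fun i _ => gaussianPDFReal_nonneg (m i) (s i) (x i)
  have hpi {m : ι → ℝ} {s : ι → NNReal} :
      Integrable (fun x : ι → ℝ => ∏ i, gaussianPDFReal (m i) (s i) (x i)) :=
    Integrable.fintype_prod fun i => integrable_gaussianPDFReal (m i) (s i)
  have h := sq_setIntegral_sub_le (μ := (volume : Measure (ι → ℝ))) (hpi (m := m) (s := s))
    (hpi (m := fun _ => 0) (s := t)) hp0 hp0 (integral_prod_gaussianPDFReal m hs)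
    (integral_prod_gaussianPDFReal _ ht) hA
  rw [← pi_gaussianReal_real m hs hA, ← pi_gaussianReal_real _ ht hA] at h
  refine h.trans ?_
  have hr (x : ι → ℝ) : √((∏ i, gaussianPDFReal (m i) (s i) (x i))
      * ∏ i, gaussianPDFReal 0 (t i) (x i))
      = ∏ i, √(gaussianPDFReal (m i) (s i) (x i) * gaussianPDFReal 0 (t i) (x i)) := by
    rw [← Finset.prod_mul_distrib, Real.sqrt_prod _ fun i _ =>
      mul_nonneg (gaussianPDFReal_nonneg _ _ _) (gaussianPDFReal_nonneg _ _ _)]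
  simp_rw [hr]
  rw [integral_fintype_prod_volume_eq_prod
    (fun i x => √(gaussianPDFReal (m i) (s i) x * gaussianPDFReal 0 (t i) x)), ← Finset.prod_pow]
  simp_rw [sq_integral_sqrt_gaussianPDFReal_mul _ (hs _) (ht _)]
  have hs' (i : ι) : (0 : ℝ) < s i := by have := hs i; positivity
  have ht' (i : ι) : (0 : ℝ) < t i := by have := ht i; positivity
  exact one_sub_prod_le_sum _ (fun i => gaussianAffinitySq_nonneg _ (hs' i).le (ht' i).le)
    (fun i => gaussianAffinitySq_le_one _ (hs' i) (ht' i))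


/-! ### Eigencoordinates -/

theorem repr_gradient_potential {d : ℕ} {B : Matrix (Fin d) (Fin d) ℝ} (hB : B.IsHermitian)
    (x : Vec d) (j : Fin d) :
    hB.eigenvectorBasis.repr (gradient (potential B) x) j
      = hB.eigenvalues j * hB.eigenvectorBasis.repr x j := by
  have hT : (Matrix.toEuclideanCLM (𝕜 := ℝ) B : Vec d →ₗ[ℝ] Vec d).IsSymmetric :=
    Matrix.isSymmetric_toEuclideanLin_iff.2 hB
  have hb : Matrix.toEuclideanCLM (𝕜 := ℝ) B (hB.eigenvectorBasis j)
      = hB.eigenvalues j • hB.eigenvectorBasis j := by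
    ext i
    simpa using congrFun (hB.mulVec_eigenvectorBasis j) i
  rw [gradient_potential hB, OrthonormalBasis.repr_apply_apply, OrthonormalBasis.repr_apply_apply]
  refine (hT (hB.eigenvectorBasis j) x).symm.trans ?_
  rw [ContinuousLinearMap.coe_coe, hb, real_inner_smul_left]

theorem potential_eq_sum {d : ℕ} {B : Matrix (Fin d) (Fin d) ℝ} (hB : B.IsHermitian)
    (x : Vec d) :
    potential B x = ∑ j, hB.eigenvalues j * hB.eigenvectorBasis.repr x j ^ 2 / 2 := by
  have h : potential B x = 1 / 2 * inner ℝ (gradient (potential B) x) x := by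
    rw [gradient_potential hB]
    simp [potential, EuclideanSpace.inner_eq_star_dotProduct]
  rw [h, ← hB.eigenvectorBasis.repr.inner_map_map, PiLp.inner_apply, Finset.mul_sum]
  refine Finset.sum_congr rfl fun j _ => ?_
  rw [repr_gradient_potential]
  simp only [RCLike.inner_apply, conj_trivial]
  ring

theorem eigenvectorBasis_dotProduct_self {d : ℕ} {B : Matrix (Fin d) (Fin d) ℝ}
    (hB : B.IsHermitian) (j : Fin d) :
    (hB.eigenvectorBasis j).ofLp ⬝ᵥ (hB.eigenvectorBasis j).ofLp = 1 := by
  have h := real_inner_self_eq_norm_sq (hB.eigenvectorBasis j)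
  rw [hB.eigenvectorBasis.orthonormal.1 j, EuclideanSpace.inner_eq_star_dotProduct] at h
  simpa using h

theorem le_eigenvalues {d : ℕ} {B : Matrix (Fin d) (Fin d) ℝ} (hB : B.IsHermitian) {α : ℝ}
    (h : (B - α • (1 : Matrix (Fin d) (Fin d) ℝ)).PosSemidef) (j : Fin d) :
    α ≤ hB.eigenvalues j := by
  have := h.dotProduct_mulVec_nonneg (hB.eigenvectorBasis j).ofLp
  have hn := eigenvectorBasis_dotProduct_self hB j
  rw [Matrix.sub_mulVec, hB.mulVec_eigenvectorBasis, Matrix.smul_mulVec, Matrix.one_mulVec,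
    dotProduct_sub, dotProduct_smul, dotProduct_smul] at this
  simp only [star_trivial, hn, smul_eq_mul, mul_one] at this
  linarith

theorem eigenvalues_le {d : ℕ} {B : Matrix (Fin d) (Fin d) ℝ} (hB : B.IsHermitian) {β : ℝ}
    (h : (β • (1 : Matrix (Fin d) (Fin d) ℝ) - B).PosSemidef) (j : Fin d) :
    hB.eigenvalues j ≤ β := by
  have := h.dotProduct_mulVec_nonneg (hB.eigenvectorBasis j).ofLp
  have hn := eigenvectorBasis_dotProduct_self hB j
  rw [Matrix.sub_mulVec, hB.mulVec_eigenvectorBasis, Matrix.smul_mulVec, Matrix.one_mulVec,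
    dotProduct_sub, dotProduct_smul, dotProduct_smul] at this
  simp only [star_trivial, hn, smul_eq_mul, mul_one] at this
  linarith

/-- Leapfrog integration of a linear oscillator is a rotation. -/
theorem repr_leapfrog {d : ℕ} {B : Matrix (Fin d) (Fin d) ℝ} (hB : B.IsHermitian) {δ : ℝ}
    (hδ : δ ≠ 0) {j : Fin d} {θ : ℝ} (hc : Real.cos θ = 1 - δ ^ 2 * hB.eigenvalues j / 2)
    (hs : Real.sin θ ≠ 0) (z : Vec d × Vec d) (k : ℕ) :
    hB.eigenvectorBasis.repr (leapfrog (gradient (potential B)) δ k z).1 j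
        = Real.cos (k * θ) * hB.eigenvectorBasis.repr z.1 j
          + δ / Real.sin θ * Real.sin (k * θ) * hB.eigenvectorBasis.repr z.2 j ∧
      hB.eigenvectorBasis.repr (leapfrog (gradient (potential B)) δ k z).2 j
        = Real.cos (k * θ) * hB.eigenvectorBasis.repr z.2 j
          - Real.sin θ / δ * Real.sin (k * θ) * hB.eigenvectorBasis.repr z.1 j := by
  induction k with
  | zero => simp [leapfrog]
  | succ k ih =>
    have hl : leapfrog (gradient (potential B)) δ (k + 1) z
        = leapfrogStep (gradient (potential B)) δ (leapfrog (gradient (potential B)) δ k z) :=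
      Function.iterate_succ_apply' _ _ _
    rw [hl]
    generalize leapfrog (gradient (potential B)) δ k z = w at ih ⊢
    obtain ⟨ih1, ih2⟩ := ih
    -- Once the eigenvalue is expressed through `θ`, one leapfrog step becomes the angle addition
    -- formulas.
    have hlam : hB.eigenvalues j = 2 * (1 - Real.cos θ) / δ ^ 2 := by
      rw [hc]
      field_simp
      ring
    have hss := Real.sin_sq_add_cos_sq θ
    simp only [leapfrogStep, map_add, map_sub, map_smul, PiLp.add_apply, PiLp.sub_apply,
      PiLp.smul_apply, smul_eq_mul, repr_gradient_potential, ih1, ih2, hlam]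
    push_cast
    rw [add_mul, one_mul, Real.cos_add, Real.sin_add]
    generalize Real.sin θ = S at *
    generalize Real.cos θ = c at *
    generalize Real.sin (k * θ) = S' at *
    generalize Real.cos (k * θ) = c' at *
    generalize hB.eigenvectorBasis.repr z.1 j = X
    generalize hB.eigenvectorBasis.repr z.2 j = V
    constructor
    · field_simp
      ring
    · field_simp
      linear_combination (S * c' * X + V * δ * S') * hss

/-- The law of a vector with independent Gaussian coordinates in an orthonormal basis. -/
def basisGaussian {d : ℕ} (b : OrthonormalBasis (Fin d) ℝ (Vec d)) (m : Fin d → ℝ)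
    (s : Fin d → NNReal) : Measure (Vec d) :=
  (Measure.pi fun j => gaussianReal (m j) (s j)).map fun y => b.repr.symm (WithLp.toLp 2 y)

theorem measurable_repr_symm_toLp {d : ℕ} (b : OrthonormalBasis (Fin d) ℝ (Vec d)) :
    Measurable fun y : Fin d → ℝ => b.repr.symm (WithLp.toLp 2 y) := by
  fun_prop

instance {d : ℕ} (b : OrthonormalBasis (Fin d) ℝ (Vec d)) (m : Fin d → ℝ)
    (s : Fin d → NNReal) : IsProbabilityMeasure (basisGaussian b m s) :=
  Measure.isProbabilityMeasure_map (measurable_repr_symm_toLp b).aemeasurable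

theorem stdGaussian_eq_basisGaussian {d : ℕ} (b : OrthonormalBasis (Fin d) ℝ (Vec d)) :
    stdGaussian (Vec d) = basisGaussian b 0 1 := by
  rw [stdGaussian_eq_map_pi_orthonormalBasis b, basisGaussian]
  congr 1
  funext y
  exact b.sum_repr_symm (WithLp.toLp 2 y)

/-- A real Gaussian of variance `0` is a Dirac mass, so the deterministic start belongs to the
Gaussian family that the chain preserves. -/
theorem dirac_eq_basisGaussian {d : ℕ} (b : OrthonormalBasis (Fin d) ℝ (Vec d)) (x : Vec d) :
    Measure.dirac x = basisGaussian b (fun j => b.repr x j) 0 := by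
  have h (a : Fin d → ℝ) : Measure.pi (fun j => Measure.dirac (a j)) = Measure.dirac a := by
    refine Measure.pi_eq fun A hA => ?_
    rw [Measure.dirac_apply' _ (MeasurableSet.univ_pi hA)]
    simp_rw [Measure.dirac_apply' _ (hA _)]
    classical
    simp only [Set.indicator_apply, Set.mem_univ_pi, Pi.one_apply]
    by_cases ha : ∀ j, a j ∈ A j
    · simp [ha]
    · rw [if_neg ha]
      obtain ⟨j, hj⟩ := not_forall.1 ha
      exact (Finset.prod_eq_zero (Finset.mem_univ j) (if_neg hj)).symm
  simp only [basisGaussian, Pi.zero_apply, gaussianReal_zero_var, h]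
  rw [Measure.map_dirac' (measurable_repr_symm_toLp b)]
  simp

theorem sq_basisGaussian_sub_le {d : ℕ} (b : OrthonormalBasis (Fin d) ℝ (Vec d)) (m : Fin d → ℝ)
    {s t : Fin d → NNReal} (hs : ∀ j, s j ≠ 0) (ht : ∀ j, t j ≠ 0) {A : Set (Vec d)}
    (hA : MeasurableSet A) :
    ((basisGaussian b m s).real A - (basisGaussian b 0 t).real A) ^ 2
      ≤ ∑ j, (1 - gaussianAffinitySq (m j) (s j) (t j)) := by
  have hm := measurable_repr_symm_toLp b
  rw [basisGaussian, basisGaussian, map_measureReal_apply hm hA, map_measureReal_apply hm hA]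
  exact sq_pi_gaussianReal_sub_le m hs ht (hm hA)

theorem gaussianReal_map_linear_combination (m : ℝ) (s : NNReal) (c c' : ℝ) :
    ((gaussianReal m s).prod (gaussianReal 0 1)).map (fun p => c * p.1 + c' * p.2)
      = gaussianReal (c * m) (Real.toNNReal (c ^ 2 * s + c' ^ 2)) := by
  have h : (fun p : ℝ × ℝ => c * p.1 + c' * p.2)
      = (fun p : ℝ × ℝ => p.1 + p.2) ∘ Prod.map (fun x => c * x) (fun x => c' * x) := rfl
  rw [h, ← Measure.map_map (by fun_prop) (by fun_prop),
    ← Measure.map_prod_map _ _ (by fun_prop) (by fun_prop), gaussianReal_map_const_mul,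
    gaussianReal_map_const_mul]
  refine (gaussianReal_conv_gaussianReal (m₁ := c * m) (m₂ := c' * 0)).trans ?_
  congr 1
  · ring
  · ext
    rw [Real.coe_toNNReal _ (by positivity)]
    simp

/-- Coordinatewise linear combinations of independent Gaussian vectors are Gaussian. -/
theorem basisGaussian_prod_map {d : ℕ} (b : OrthonormalBasis (Fin d) ℝ (Vec d)) (m : Fin d → ℝ)
    (s : Fin d → NNReal) (c c' : Fin d → ℝ) {F : Vec d × Vec d → Vec d}
    (hF : Measurable F)
    (hFc : ∀ z j, b.repr (F z) j = c j * b.repr z.1 j + c' j * b.repr z.2 j) :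
    ((basisGaussian b m s).prod (basisGaussian b 0 1)).map F
      = basisGaussian b (fun j => c j * m j)
          (fun j => Real.toNNReal (c j ^ 2 * s j + c' j ^ 2)) := by
  have hm := measurable_repr_symm_toLp b
  rw [basisGaussian, basisGaussian, Measure.map_prod_map _ _ hm hm,
    Measure.map_map hF (by fun_prop),
    ← (measurePreserving_arrowProdEquivProdArrow ℝ ℝ (Fin d) (fun j => gaussianReal (m j) (s j))
      (fun j => gaussianReal ((0 : Fin d → ℝ) j) ((1 : Fin d → NNReal) j))).map_eq,
    Measure.map_map (by fun_prop) (MeasurableEquiv.measurable _), basisGaussian]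
  simp_rw [← gaussianReal_map_linear_combination]
  rw [← Measure.pi_map_pi (fun i => by fun_prop), Measure.map_map hm (by fun_prop)]
  simp only [Pi.zero_apply, Pi.one_apply]
  congr 1
  funext y
  simp only [Function.comp]
  rw [LinearIsometryEquiv.eq_symm_apply]
  ext j
  rw [hFc]
  simp [MeasurableEquiv.arrowProdEquivProdArrow, Equiv.arrowProdEquivProdArrow]


/-! ### The target and the kernel in eigencoordinates -/

theorem target_eq_basisGaussian {d : ℕ} {B : Matrix (Fin d) (Fin d) ℝ} (hB : B.IsHermitian)
    (hpos : ∀ j, 0 < hB.eigenvalues j) :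
    target B = basisGaussian hB.eigenvectorBasis 0
      (fun j => Real.toNNReal (hB.eigenvalues j)⁻¹) := by
  set b := hB.eigenvectorBasis
  set t : Fin d → NNReal := fun j => Real.toNNReal (hB.eigenvalues j)⁻¹
  have htc (j : Fin d) : (t j : ℝ) = (hB.eigenvalues j)⁻¹ :=
    Real.coe_toNNReal _ (inv_pos.2 (hpos j)).le
  have ht (j : Fin d) : t j ≠ 0 := by
    rw [← NNReal.coe_ne_zero, htc]
    exact (inv_pos.2 (hpos j)).ne'
  have hm := measurable_repr_symm_toLp b
  have hmp : MeasurePreserving (fun y : Fin d → ℝ => b.repr.symm (WithLp.toLp 2 y)) :=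
    b.repr.symm.measurePreserving.comp (PiLp.volume_preserving_toLp (Fin d))
  have hemb : MeasurableEmbedding (fun y : Fin d → ℝ => b.repr.symm (WithLp.toLp 2 y)) :=
    b.repr.symm.toHomeomorph.measurableEmbedding.comp
      (MeasurableEquiv.toLp 2 (Fin d → ℝ)).measurableEmbedding
  set c : ℝ := ∏ j, √(2 * Real.pi * t j)
  have hc : c ≠ 0 := by
    refine Finset.prod_ne_zero_iff.2 fun j _ => ?_
    have := Real.pi_pos
    have := inv_pos.2 (hpos j)
    rw [htc]
    positivity
  have hexp (y : Fin d → ℝ) : Real.exp (-potential B (b.repr.symm (WithLp.toLp 2 y)))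
      = c * ∏ j, gaussianPDFReal 0 (t j) (y j) := by
    rw [potential_eq_sum hB, ← Finset.sum_neg_distrib, Real.exp_sum, ← Finset.prod_mul_distrib]
    refine Finset.prod_congr rfl fun j _ => ?_
    have h1 : √(2 * Real.pi * t j) ≠ 0 := (Finset.prod_ne_zero_iff.1 hc) j (Finset.mem_univ j)
    rw [gaussianPDFReal, ← mul_assoc, mul_inv_cancel₀ h1, one_mul, htc]
    congr 1
    have := (hpos j).ne'
    simp only [b, LinearIsometryEquiv.apply_symm_apply, sub_zero]
    field_simp
  -- The isometry to eigencoordinates preserves volume, and the product density has integral one, so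
  -- the normalising constant is `c`.
  have hZ : ∫ x, Real.exp (-potential B x) = c := by
    rw [← hmp.integral_comp hemb]
    simp_rw [hexp]
    rw [integral_const_mul, integral_prod_gaussianPDFReal (fun _ => 0) ht, mul_one]
  ext A hA
  rw [target, tilted_apply' _ _ hA, hZ, ← hmp.setLIntegral_comp_preimage_emb hemb, basisGaussian,
    Measure.map_apply hm hA, pi_gaussianReal_eq_withDensity _ ht, withDensity_apply _ (hm hA)]
  refine lintegral_congr fun y => ?_
  rw [hexp, mul_div_cancel_left₀ _ hc]
  rfl

theorem lintegral_uniformOn_range {N : ℕ} (f : ℕ → ENNReal) :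
    ∫⁻ k, f k ∂(uniformOn (Finset.range N : Set ℕ))
      = (N : ENNReal)⁻¹ * ∑ k ∈ Finset.range N, f k := by
  rw [uniformOn, ProbabilityTheory.cond, lintegral_smul_measure, lintegral_finset,
    Measure.count_apply_finset, Finset.card_range]
  simp

theorem bind_hmcKernel_eq_sum {d : ℕ} {B : Matrix (Fin d) (Fin d) ℝ} (hB : B.IsHermitian)
    {α δ : ℝ} (hα : 0 < α) (hδ : 0 < δ) {θ : Fin d → ℝ}
    (hc : ∀ j, Real.cos (θ j) = 1 - δ ^ 2 * hB.eigenvalues j / 2)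
    (hs : ∀ j, Real.sin (θ j) ≠ 0) (m : Fin d → ℝ) (s : Fin d → NNReal) :
    (basisGaussian hB.eigenvectorBasis m s).bind (hmcKernel B α δ)
      = (⌈10 * Real.pi / √α / δ⌉₊ : ENNReal)⁻¹ •
        ∑ k ∈ Finset.range ⌈10 * Real.pi / √α / δ⌉₊,
          basisGaussian hB.eigenvectorBasis (fun j => Real.cos (k * θ j) * m j)
            (fun j => Real.toNNReal (Real.cos (k * θ j) ^ 2 * s j
              + (δ / Real.sin (θ j) * Real.sin (k * θ j)) ^ 2)) := by
  have hU := isProbabilityMeasure_uniformOn_stepCounts hα hδ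
  have hF := measurable_hmcStep (measurable_gradient_potential hB) δ
  set g := gradient (potential B)
  -- Regrouping the draws as `((x, v), k)` allows conditioning on `k`; for fixed `k` the transition
  -- is a coordinatewise linear combination of `x` and `v`.
  rw [bind_hmcKernel hB hα hδ, drawLaw, ← Measure.prodAssoc_prod,
    Measure.map_map hF (MeasurableEquiv.measurable _)]
  ext A hA
  have hm : Measurable
      (hmcStep g δ ∘ MeasurableEquiv.prodAssoc (α := Vec d) (β := Vec d) (γ := ℕ)) :=
    hF.comp (MeasurableEquiv.measurable _)
  rw [Measure.map_apply hm hA, Measure.prod_apply_symm (hm hA)]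
  have hk (k : ℕ) : ((basisGaussian hB.eigenvectorBasis m s).prod (stdGaussian (Vec d)))
      ((fun z => (z, k)) ⁻¹' (hmcStep g δ ∘ MeasurableEquiv.prodAssoc ⁻¹' A))
      = basisGaussian hB.eigenvectorBasis (fun j => Real.cos (k * θ j) * m j)
            (fun j => Real.toNNReal (Real.cos (k * θ j) ^ 2 * s j
              + (δ / Real.sin (θ j) * Real.sin (k * θ j)) ^ 2)) A := by
    have hFk : Measurable (fun z : Vec d × Vec d => hmcStep g δ (z.1, (z.2, k))) :=
      hF.comp (by fun_prop)
    rw [← basisGaussian_prod_map hB.eigenvectorBasis m s _ _ hFk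
      (fun z j => (repr_leapfrog hB hδ.ne' (hc j) (hs j) z k).1), Measure.map_apply hFk hA,
      stdGaussian_eq_basisGaussian hB.eigenvectorBasis]
    rfl
  simp_rw [hk]
  rw [stepCounts_eq hδ, lintegral_uniformOn_range]
  simp

/-! ### Contraction -/

/-- The law of the chain given the integration times, when these contribute the factor `R`
to the mean: as `R` decreases from `1` to `0`, it interpolates between a Dirac mass and the
stationary law of the chain. -/
def conditionalLaw {d : ℕ} (b : OrthonormalBasis (Fin d) ℝ (Vec d)) (y τ R : Fin d → ℝ) :
    Measure (Vec d) :=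
  basisGaussian b (fun j => R j * y j) (fun j => Real.toNNReal ((1 - R j ^ 2) * τ j))

instance {d : ℕ} (b : OrthonormalBasis (Fin d) ℝ (Vec d)) (y τ R : Fin d → ℝ) :
    IsProbabilityMeasure (conditionalLaw b y τ R) :=
  inferInstanceAs (IsProbabilityMeasure (basisGaussian _ _ _))

/-- With `c = cos(kθ)`, the new variance is `c² (1 - R²) τ + (1 - c²) τ = (1 - (cR)²) τ`: the family
is closed under transitions, with `R` replaced by `cR`. -/
theorem bind_conditionalLaw {d : ℕ} {B : Matrix (Fin d) (Fin d) ℝ} (hB : B.IsHermitian)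
    {α δ : ℝ} (hα : 0 < α) (hδ : 0 < δ) {θ : Fin d → ℝ}
    (hc : ∀ j, Real.cos (θ j) = 1 - δ ^ 2 * hB.eigenvalues j / 2)
    (hs : ∀ j, Real.sin (θ j) ≠ 0) (y : Fin d → ℝ) {R : Fin d → ℝ} (hR : ∀ j, R j ^ 2 ≤ 1) :
    (conditionalLaw hB.eigenvectorBasis y (fun j => (δ / Real.sin (θ j)) ^ 2) R).bind
        (hmcKernel B α δ)
      = (⌈10 * Real.pi / √α / δ⌉₊ : ENNReal)⁻¹ •
        ∑ k ∈ Finset.range ⌈10 * Real.pi / √α / δ⌉₊,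
          conditionalLaw hB.eigenvectorBasis y (fun j => (δ / Real.sin (θ j)) ^ 2)
            (fun j => Real.cos (k * θ j) * R j) := by
  rw [conditionalLaw, bind_hmcKernel_eq_sum hB hα hδ hc hs]
  congr 1
  refine Finset.sum_congr rfl fun k _ => ?_
  rw [conditionalLaw]
  congr 1
  · funext j
    ring
  · funext j
    rw [Real.coe_toNNReal _ (mul_nonneg (sub_nonneg.2 (hR j)) (sq_nonneg _))]
    congr 1
    rw [mul_pow _ (Real.sin _), Real.sin_sq (k * θ j)]
    ring

/-- Jensen's inequality for the square; it passes from mixtures to their components. -/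
theorem sq_avg_sub_le {N : ℕ} (hN : 0 < N) (a : ℕ → ℝ) (c : ℝ) :
    ((N : ℝ)⁻¹ * ∑ k ∈ Finset.range N, a k - c) ^ 2
      ≤ (N : ℝ)⁻¹ * ∑ k ∈ Finset.range N, (a k - c) ^ 2 := by
  have hN' : (0 : ℝ) < N := by exact_mod_cast hN
  have h := sq_sum_le_card_mul_sum_sq (s := Finset.range N) (f := fun k => a k - c)
  rw [Finset.card_range] at h
  have h1 : (N : ℝ)⁻¹ * ∑ k ∈ Finset.range N, a k - c
      = (N : ℝ)⁻¹ * ∑ k ∈ Finset.range N, (a k - c) := by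
    rw [Finset.sum_sub_distrib, mul_sub]
    simp [hN'.ne']
  rw [h1, mul_pow]
  calc (N : ℝ)⁻¹ ^ 2 * (∑ k ∈ Finset.range N, (a k - c)) ^ 2
      ≤ (N : ℝ)⁻¹ ^ 2 * (N * ∑ k ∈ Finset.range N, (a k - c) ^ 2) := by gcongr
    _ = _ := by field_simp

theorem bind_avg_real {Ω : Type*} [MeasurableSpace Ω] (κ : Kernel Ω Ω) [IsMarkovKernel κ]
    (G : ℕ → Measure Ω) [∀ k, IsProbabilityMeasure (G k)] (N : ℕ) {A : Set Ω}
    (hA : MeasurableSet A) :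
    (((N : ENNReal)⁻¹ • ∑ k ∈ Finset.range N, G k).bind κ).real A
      = (N : ℝ)⁻¹ * ∑ k ∈ Finset.range N, ((G k).bind κ).real A := by
  simp only [Measure.real]
  rw [Measure.bind_apply hA (Kernel.aemeasurable _), lintegral_smul_measure,
    lintegral_finsetSum_measure, smul_eq_mul, ENNReal.toReal_mul, ENNReal.toReal_inv,
    ENNReal.toReal_natCast]
  simp_rw [← Measure.bind_apply hA (Kernel.aemeasurable κ)]
  rw [ENNReal.toReal_sum fun k _ => measure_ne_top _ _]

/-- If a kernel acts on a family of laws `L R` by averaging over multiplications of the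
parameter `R` by `c k`, then a bound on the squared distance to `ν` that is affine in the `R j ^ 2`
improves geometrically along the chain. -/
theorem sq_bind_pow_sub_le {ι Ω : Type*} [Fintype ι] [MeasurableSpace Ω] (κ : Kernel Ω Ω)
    [IsMarkovKernel κ] (L : (ι → ℝ) → Measure Ω) [∀ R, IsProbabilityMeasure (L R)]
    {N : ℕ} (hN : 0 < N) {c : ℕ → ι → ℝ} (hc1 : ∀ k j, c k j ^ 2 ≤ 1)
    (hL : ∀ R : ι → ℝ, (∀ j, R j ^ 2 ≤ 1) → (L R).bind κ
      = (N : ENNReal)⁻¹ • ∑ k ∈ Finset.range N, L (fun j => c k j * R j))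
    {ρ : ℝ} (hρ : 0 ≤ ρ) (hc : ∀ j, ∑ k ∈ Finset.range N, c k j ^ 2 ≤ ρ * N)
    (ν : Measure Ω) {A : Set Ω} (hA : MeasurableSet A) {U w : ι → ℝ} (hw : ∀ j, 0 ≤ w j)
    (hbase : ∀ R : ι → ℝ, (∀ j, R j ^ 2 ≤ 1) →
      ((L R).real A - ν.real A) ^ 2 ≤ ∑ j, (U j + w j * R j ^ 2))
    (K : ℕ) (R : ι → ℝ) (hR : ∀ j, R j ^ 2 ≤ 1) :
    (((L R).bind ⇑(κ ^ K)).real A - ν.real A) ^ 2 ≤ ∑ j, (U j + ρ ^ K * (w j * R j ^ 2)) := by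
  have hN' : (0 : ℝ) < N := by exact_mod_cast hN
  induction K generalizing R with
  | zero =>
    have : (L R).bind ⇑(κ ^ 0) = L R := Measure.id_comp
    rw [this]
    simpa using hbase R hR
  | succ K ih =>
    -- The first transition is peeled off, not the last: it moves `L R` within the family, and the
    -- induction hypothesis applies to each new parameter.
    have hstep : (L R).bind ⇑(κ ^ (K + 1)) = ((L R).bind κ).bind ⇑(κ ^ K) := by
      rw [pow_succ]
      exact Measure.comp_assoc.symm
    have := isMarkovKernel_pow κ K
    rw [hstep, hL R hR, bind_avg_real (κ ^ K) (fun k => L (fun j => c k j * R j)) N hA]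
    refine (sq_avg_sub_le hN _ _).trans ?_
    have hcR (k : ℕ) (j : ι) : (c k j * R j) ^ 2 ≤ 1 := by
      rw [mul_pow]
      exact mul_le_one₀ (hc1 k j) (sq_nonneg _) (hR j)
    calc (N : ℝ)⁻¹ * ∑ k ∈ Finset.range N,
          (((L (fun j => c k j * R j)).bind ⇑(κ ^ K)).real A - ν.real A) ^ 2
        ≤ (N : ℝ)⁻¹ * ∑ k ∈ Finset.range N,
          ∑ j, (U j + ρ ^ K * (w j * (c k j * R j) ^ 2)) := by
          gcongr with k
          exact ih _ (hcR k)
      _ = (N : ℝ)⁻¹ * ∑ j, (N * U j + ρ ^ K * (w j * R j ^ 2)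
            * ∑ k ∈ Finset.range N, c k j ^ 2) := by
          rw [Finset.sum_comm]
          congr 1
          refine Finset.sum_congr rfl fun j _ => ?_
          rw [Finset.sum_add_distrib, Finset.mul_sum]
          congr 1
          · simp
          · refine Finset.sum_congr rfl fun k _ => ?_
            ring
      _ ≤ (N : ℝ)⁻¹ * ∑ j, (N * U j + ρ ^ K * (w j * R j ^ 2) * (ρ * N)) := by
          gcongr with j
          · have := hw j
            positivity
          · exact hc j
      _ = ∑ j, (U j + ρ ^ (K + 1) * (w j * R j ^ 2)) := by
          rw [Finset.mul_sum]
          refine Finset.sum_congr rfl fun j _ => ?_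
          field_simp
          ring


/-! ### Averages of squared cosines -/

/-- The sum telescopes, because `2 sin θ cos(2kθ) = sin((2k+1)θ) - sin((2k-1)θ)`. -/
theorem two_mul_sin_mul_sum_cos (θ : ℝ) (N : ℕ) :
    2 * Real.sin θ * ∑ k ∈ Finset.range N, Real.cos (2 * (k * θ))
      = Real.sin (2 * (N * θ) - θ) + Real.sin θ := by
  induction N with
  | zero => simp
  | succ N ih =>
    rw [Finset.sum_range_succ, mul_add, ih]
    push_cast
    rw [show 2 * (((N : ℝ) + 1) * θ) - θ = 2 * (N * θ) + θ by ring, Real.sin_add, Real.sin_sub]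
    ring

theorem sum_cos_sq_le {θ : ℝ} (hθ : 0 < Real.sin θ) (N : ℕ) :
    ∑ k ∈ Finset.range N, Real.cos (k * θ) ^ 2 ≤ N / 2 + 1 / (2 * Real.sin θ) := by
  have h1 : ∑ k ∈ Finset.range N, Real.cos (k * θ) ^ 2
      = N / 2 + (∑ k ∈ Finset.range N, Real.cos (2 * (k * θ))) / 2 := by
    simp_rw [Real.cos_sq]
    rw [Finset.sum_add_distrib, Finset.sum_div, Finset.sum_const, Finset.card_range,
      nsmul_eq_mul]
    ring
  have h2 : ∑ k ∈ Finset.range N, Real.cos (2 * (k * θ)) ≤ 1 / Real.sin θ := by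
    rw [le_div_iff₀ hθ]
    have := two_mul_sin_mul_sum_cos θ N
    linarith [Real.sin_le_one (2 * (N * θ) - θ), Real.sin_le_one θ]
  rw [h1]
  have h3 : 1 / (2 * Real.sin θ) = 1 / Real.sin θ / 2 := by field_simp
  linarith

theorem sin_arccos_one_sub_sq {a : ℝ} (h0 : 0 ≤ a) (h1 : a ≤ 1) :
    Real.sin (Real.arccos (1 - a / 2)) ^ 2 = a * (1 - a / 4) := by
  rw [Real.sin_arccos, Real.sq_sqrt (by nlinarith)]
  ring

theorem sin_arccos_one_sub_pos {a : ℝ} (h0 : 0 < a) (h1 : a ≤ 1) :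
    0 < Real.sin (Real.arccos (1 - a / 2)) := by
  rw [Real.sin_arccos]
  exact Real.sqrt_pos.2 (by nlinarith)

/-- Over integration times up to `10π/√α`, the squared cosine of the phase is on average
at most `3/4`. -/
theorem sum_cos_sq_arccos_le {α l δ : ℝ} (hα : 0 < α) (hl : α ≤ l) (hδ : 0 < δ)
    (h1 : δ ^ 2 * l ≤ 1) {N : ℕ} (hN : 10 * Real.pi / √α / δ ≤ N) :
    ∑ k ∈ Finset.range N, Real.cos (k * Real.arccos (1 - δ ^ 2 * l / 2)) ^ 2 ≤ 3 / 4 * N := by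
  have h0 : 0 < δ ^ 2 * l := mul_pos (by positivity) (hα.trans_le hl)
  have hs := sin_arccos_one_sub_pos h0 h1
  have hsq := sin_arccos_one_sub_sq h0.le h1
  set S := Real.sin (Real.arccos (1 - δ ^ 2 * l / 2))
  refine (sum_cos_sq_le hs N).trans ?_
  have hα' : √α ^ 2 = α := Real.sq_sqrt hα.le
  have hαp : 0 < √α := Real.sqrt_pos.2 hα
  -- Here `S² = a (1 - a/4)` with `δ²α ≤ a = δ²l ≤ 1`. Together with `N δ √α ≥ 10π` this gives `N S
  -- ≥ 5π`, more than the `2` that is needed.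
  have hS : δ * √α / 2 ≤ S := by
    refine (sq_le_sq₀ (by positivity) hs.le).1 ?_
    rw [hsq, div_pow, mul_pow, hα']
    nlinarith [mul_le_mul_of_nonneg_left hl (sq_nonneg δ)]
  have hNS : 2 ≤ N * S := by
    have hpi := Real.pi_gt_three
    calc (2 : ℝ) ≤ 10 * Real.pi / √α / δ * (δ * √α / 2) := by
          field_simp
          linarith
      _ ≤ N * S := by gcongr
  have : 1 / (2 * S) ≤ N / 4 := by
    rw [div_le_iff₀ (by positivity)]
    linarith
  linarith

/-! ### Affinity of a conditional law and the target, in one coordinate -/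

/-- Rescaling by `l` leaves only the ratio of the two variances, `(1 - r²) / (1 - u)`, and the
scale-free offset `l y²`. -/
theorem gaussianAffinitySq_eq {l u r : ℝ} (y : ℝ) (hl : 0 < l) (hu1 : u < 1) (hr : r ^ 2 ≤ 1) :
    gaussianAffinitySq (r * y) ((1 - r ^ 2) * (1 / (l * (1 - u)))) l⁻¹
      = 2 * √((1 - r ^ 2) / (1 - u)) / (1 + (1 - r ^ 2) / (1 - u))
        * Real.exp (-(r ^ 2 * (l * y ^ 2) / (2 * (1 + (1 - r ^ 2) / (1 - u))))) := by
  have hu : 0 < 1 - u := by linarith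
  have hr' : 0 ≤ 1 - r ^ 2 := by linarith
  have hA : 0 ≤ (1 - r ^ 2) / (1 - u) := by positivity
  have h1 : (1 - r ^ 2) * (1 / (l * (1 - u))) = (1 - r ^ 2) / (1 - u) / l := by field_simp
  rw [gaussianAffinitySq, h1]
  set A := (1 - r ^ 2) / (1 - u)
  have h2 : √(A / l * l⁻¹) = √A / l := by
    rw [show A / l * l⁻¹ = A / l ^ 2 by field_simp, Real.sqrt_div hA, Real.sqrt_sq hl.le]
  rw [h2]
  have h3 : A / l + l⁻¹ = (1 + A) / l := by field_simp; ring
  rw [h3]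
  congr 1
  · field_simp
  · congr 2
    field_simp

/-- The affinity is stationary at equal variances, so a variance ratio `A` costs at most `(1 - A)²`.
This makes the discretisation bias quadratic in `u`. -/
theorem one_sub_gaussianAffinitySq_le {l u r : ℝ} (y : ℝ) (hl : 0 < l) (hu : 0 ≤ u)
    (hu4 : u ≤ 1 / 4) (hr : r ^ 2 ≤ 1) :
    1 - gaussianAffinitySq (r * y) ((1 - r ^ 2) * (1 / (l * (1 - u)))) l⁻¹
      ≤ 2 * u ^ 2 + (2 + l * y ^ 2 / 2) * r ^ 2 := by
  rw [gaussianAffinitySq_eq y hl (by linarith) hr]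
  have hu' : 0 < 1 - u := by linarith
  have hr' : 0 ≤ 1 - r ^ 2 := by linarith
  have hA : 0 ≤ (1 - r ^ 2) / (1 - u) := by positivity
  have hA1 : (1 - (1 - r ^ 2) / (1 - u)) ^ 2 ≤ 2 * u ^ 2 + 2 * r ^ 2 := by
    have : 1 - (1 - r ^ 2) / (1 - u) = (r ^ 2 - u) / (1 - u) := by field_simp; ring
    rw [this, div_pow, div_le_iff₀ (by positivity)]
    have h1 : (r ^ 2 - u) ^ 2 ≤ r ^ 2 + u ^ 2 := by nlinarith [sq_nonneg r]
    have h2 : 1 ≤ 2 * (1 - u) ^ 2 := by nlinarith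
    nlinarith [sq_nonneg r, sq_nonneg u]
  set A := (1 - r ^ 2) / (1 - u)
  have hE0 : 0 ≤ r ^ 2 * (l * y ^ 2) / (2 * (1 + A)) := by positivity
  have hE : r ^ 2 * (l * y ^ 2) / (2 * (1 + A)) ≤ r ^ 2 * (l * y ^ 2) / 2 := by
    gcongr
    linarith
  have hexp := Real.one_sub_le_exp_neg (r ^ 2 * (l * y ^ 2) / (2 * (1 + A)))
  set E := r ^ 2 * (l * y ^ 2) / (2 * (1 + A))
  have ha := Real.sqrt_nonneg A
  have haA := Real.sq_sqrt hA
  set a := √A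
  have hg0 : 0 ≤ 2 * a / (1 + A) := by positivity
  have hg1 : 2 * a / (1 + A) ≤ 1 := by
    rw [div_le_one (by positivity)]
    nlinarith [sq_nonneg (a - 1)]
  have hg : 1 - 2 * a / (1 + A) ≤ (1 - A) ^ 2 := by
    have h1 : 1 - 2 * a / (1 + A) = (1 - a) ^ 2 / (1 + A) := by
      rw [← haA]
      field_simp
      ring
    have h2 : (1 - a) ^ 2 / (1 + A) ≤ (1 - a) ^ 2 :=
      div_le_self (sq_nonneg _) (by linarith)
    have h3 : (1 - A) ^ 2 = (1 - a) ^ 2 * (1 + a) ^ 2 := by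
      rw [← haA]
      ring
    have h4 : 1 ≤ (1 + a) ^ 2 := by nlinarith
    nlinarith [sq_nonneg (1 - a)]
  -- With `g = 2a/(1+A) ≤ 1`: `1 - g e^(-E) ≤ (1 - g) + E`, where `1 - g ≤ 2u² + 2r²` and `E ≤ r² l
  -- y² / 2`.
  nlinarith

/-- A bound that never exceeds `1`, for the regime where only `K ≥ 1` is available and the weight `2
+ l y² / 2` of the general bound is too large. -/
theorem one_sub_gaussianAffinitySq_le_of_small {l u r y : ℝ} (hl : 0 < l) (hu : 0 ≤ u)
    (hu4 : u ≤ 1 / 4) (hr : r ^ 2 ≤ 1) (hy : l * y ^ 2 ≤ 1 / 2) :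
    1 - gaussianAffinitySq (r * y) ((1 - r ^ 2) * (1 / (l * (1 - u)))) l⁻¹
      ≤ 5 / 6 + 1 / 6 * r ^ 2 := by
  rw [gaussianAffinitySq_eq y hl (by linarith) hr]
  have hu' : 0 < 1 - u := by linarith
  have hr' : 0 ≤ 1 - r ^ 2 := by linarith
  have hA : 1 - r ^ 2 ≤ (1 - r ^ 2) / (1 - u) := by
    rw [le_div_iff₀ hu']
    nlinarith
  have hA0 : 0 ≤ (1 - r ^ 2) / (1 - u) := by positivity
  have hA2 : (1 - r ^ 2) / (1 - u) ≤ 4 / 3 := by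
    rw [div_le_iff₀ hu']
    nlinarith [sq_nonneg r]
  set A := (1 - r ^ 2) / (1 - u)
  have hE : r ^ 2 * (l * y ^ 2) / (2 * (1 + A)) ≤ 1 / 4 := by
    rw [div_le_iff₀ (by positivity)]
    have : 0 ≤ l * y ^ 2 := by positivity
    nlinarith [sq_nonneg r]
  have hexp := Real.one_sub_le_exp_neg (r ^ 2 * (l * y ^ 2) / (2 * (1 + A)))
  set E := r ^ 2 * (l * y ^ 2) / (2 * (1 + A))
  have ha := Real.sqrt_nonneg A
  have haA := Real.sq_sqrt hA0
  set a := √A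
  have ha2 : a ≤ 2 := by nlinarith
  -- Since `1 + A ≤ 7/3`, it suffices that `1 - r² ≤ A = a² ≤ 2a`. With `e^(-E) ≥ 3/4` the affinity
  -- is then at least `(9/28)(1 - r²)`, which exceeds the required `(1 - r²)/6`.
  have hg : (1 - r ^ 2) * (3 / 7) ≤ 2 * a / (1 + A) := by
    rw [le_div_iff₀ (by positivity)]
    nlinarith
  nlinarith


/-! ### Distance to the target -/

theorem tvDist_le_of_forall {Ω : Type*} [MeasurableSpace Ω] {μ ν : Measure Ω} {ε : ℝ}
    (h : ∀ A, MeasurableSet A → |μ.real A - ν.real A| ≤ ε) : tvDist μ ν ≤ ε :=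
  haveI : Nonempty {A : Set Ω // MeasurableSet A} := ⟨⟨∅, MeasurableSet.empty⟩⟩
  ciSup_le fun A => h A.1 A.2

theorem abs_real_sub_real_le_one {Ω : Type*} [MeasurableSpace Ω] (μ ν : Measure Ω)
    [IsProbabilityMeasure μ] [IsProbabilityMeasure ν] (A : Set Ω) :
    |μ.real A - ν.real A| ≤ 1 := by
  have h1 : μ.real A ≤ 1 := measureReal_le_one
  have h2 : ν.real A ≤ 1 := measureReal_le_one
  have h3 : 0 ≤ μ.real A := measureReal_nonneg
  have h4 : 0 ≤ ν.real A := measureReal_nonneg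
  rw [abs_le]
  constructor <;> linarith

theorem sq_hmcKernel_pow_sub_target_le {d : ℕ} {B : Matrix (Fin d) (Fin d) ℝ}
    (hB : B.IsHermitian) {α β δ : ℝ} (hα : 0 < α) (hlo : ∀ j, α ≤ hB.eigenvalues j)
    (hhi : ∀ j, hB.eigenvalues j ≤ β) (hδ : 0 < δ) (hδβ : δ ^ 2 * β ≤ 1) (x : Vec d)
    {U w : Fin d → ℝ} (hU : ∀ j, 0 ≤ U j) (hw : ∀ j, 0 ≤ w j) (hUw : ∀ j, 1 ≤ U j + w j)
    (haff : ∀ j r, r ^ 2 ≤ 1 →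
      1 - gaussianAffinitySq (r * hB.eigenvectorBasis.repr x j)
        ((1 - r ^ 2) * (1 / (hB.eigenvalues j * (1 - δ ^ 2 * hB.eigenvalues j / 4))))
        (hB.eigenvalues j)⁻¹ ≤ U j + w j * r ^ 2)
    (K : ℕ) {A : Set (Vec d)} (hA : MeasurableSet A) :
    (((hmcKernel B α δ ^ K) x).real A - (target B).real A) ^ 2
      ≤ ∑ j, (U j + (3 / 4) ^ K * w j) := by
  have := isMarkovKernel_hmcKernel hB hα hδ
  have hpos (j : Fin d) : 0 < hB.eigenvalues j := hα.trans_le (hlo j)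
  have ha0 (j : Fin d) : 0 < δ ^ 2 * hB.eigenvalues j := mul_pos (by positivity) (hpos j)
  have ha1 (j : Fin d) : δ ^ 2 * hB.eigenvalues j ≤ 1 :=
    (mul_le_mul_of_nonneg_left (hhi j) (sq_nonneg δ)).trans hδβ
  set y : Fin d → ℝ := fun j => hB.eigenvectorBasis.repr x j with hy
  set θ : Fin d → ℝ := fun j => Real.arccos (1 - δ ^ 2 * hB.eigenvalues j / 2)
  have hc (j : Fin d) : Real.cos (θ j) = 1 - δ ^ 2 * hB.eigenvalues j / 2 :=
    Real.cos_arccos (by linarith [ha1 j]) (by linarith [ha0 j])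
  have hs (j : Fin d) : 0 < Real.sin (θ j) := sin_arccos_one_sub_pos (ha0 j) (ha1 j)
  have hu (j : Fin d) : 0 < 1 - δ ^ 2 * hB.eigenvalues j / 4 := by linarith [ha1 j]
  have hτ (j : Fin d) : (δ / Real.sin (θ j)) ^ 2
      = 1 / (hB.eigenvalues j * (1 - δ ^ 2 * hB.eigenvalues j / 4)) := by
    have h1 := sin_arccos_one_sub_sq (ha0 j).le (ha1 j)
    have h2 := (hpos j).ne'
    have h3 := (hu j).ne'
    rw [div_pow, h1]
    field_simp
  have hdirac : (hmcKernel B α δ ^ K) x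
      = (conditionalLaw hB.eigenvectorBasis y (fun j => (δ / Real.sin (θ j)) ^ 2)
          (fun _ => 1)).bind ⇑(hmcKernel B α δ ^ K) := by
    -- At `R = 1` the variances vanish and the means are the coordinates of `x`.
    have : conditionalLaw hB.eigenvectorBasis y (fun j => (δ / Real.sin (θ j)) ^ 2) (fun _ => 1)
        = Measure.dirac x := by
      rw [dirac_eq_basisGaussian hB.eigenvectorBasis x, conditionalLaw]
      congr 1
      · simp [hy]
      · funext j
        simp
    rw [this, Measure.dirac_bind (Kernel.measurable _)]
  rw [hdirac, target_eq_basisGaussian hB hpos]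
  have := sq_bind_pow_sub_le (hmcKernel B α δ)
    (conditionalLaw hB.eigenvectorBasis y (fun j => (δ / Real.sin (θ j)) ^ 2))
    (ceil_steps_pos hα hδ) (c := fun k j => Real.cos (k * θ j))
    (fun k j => Real.cos_sq_le_one _)
    (fun R hR => bind_conditionalLaw hB hα hδ hc (fun j => (hs j).ne') y hR)
    (ρ := 3 / 4) (by norm_num)
    (fun j => sum_cos_sq_arccos_le hα (hlo j) hδ (ha1 j) (Nat.le_ceil _))
    (basisGaussian hB.eigenvectorBasis 0 (fun j => Real.toNNReal (hB.eigenvalues j)⁻¹)) hA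
    (U := U) (w := w) hw ?_ K (fun _ => 1) (by simp)
  · simpa using this
  intro R hR
  -- If some `R i ^ 2 = 1`, that coordinate is degenerate and the law has no density; then the
  -- `i`-th term alone is `U i + w i ≥ 1`, a trivial bound.
  by_cases hR1 : ∃ i, R i ^ 2 = 1
  · obtain ⟨i, hi⟩ := hR1
    have h1 : ∀ j, 0 ≤ U j + w j * R j ^ 2 := fun j =>
      add_nonneg (hU j) (mul_nonneg (hw j) (sq_nonneg _))
    have h2 := Finset.single_le_sum (f := fun j => U j + w j * R j ^ 2) (fun j _ => h1 j)
      (Finset.mem_univ i)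
    simp only [hi, mul_one] at h2
    refine le_trans ?_ ((hUw i).trans h2)
    exact (sq_le_one_iff_abs_le_one _).2 (abs_real_sub_real_le_one _ _ A)
  · have hlt (j : Fin d) : 0 < 1 - R j ^ 2 :=
      sub_pos.2 (lt_of_le_of_ne (hR j) fun h => hR1 ⟨j, h⟩)
    have hv (j : Fin d) : 0 < (1 - R j ^ 2) * (δ / Real.sin (θ j)) ^ 2 :=
      mul_pos (hlt j) (pow_pos (div_pos hδ (hs j)) 2)
    refine (sq_basisGaussian_sub_le hB.eigenvectorBasis _
      (fun j => (Real.toNNReal_pos.2 (hv j)).ne')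
      (fun j => (Real.toNNReal_pos.2 (inv_pos.2 (hpos j))).ne') hA).trans ?_
    refine Finset.sum_le_sum fun j _ => ?_
    rw [Real.coe_toNNReal _ (hv j).le, Real.coe_toNNReal _ (inv_pos.2 (hpos j)).le, hτ]
    exact haff j (R j) (hR j)

/-! ### Constants -/

theorem sum_repr_sq_le {d : ℕ} (b : OrthonormalBasis (Fin d) ℝ (Vec d)) (x : Vec d) :
    ∑ j, b.repr x j ^ 2 ≤ d * supNorm x ^ 2 := by
  have h1 : ∑ j, b.repr x j ^ 2 = ∑ j, x j ^ 2 := by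
    have := b.repr.norm_map x
    have h2 := EuclideanSpace.norm_sq_eq (b.repr x)
    rw [this, EuclideanSpace.norm_sq_eq] at h2
    simpa using h2.symm
  rw [h1]
  calc ∑ j, x j ^ 2 ≤ ∑ _j : Fin d, supNorm x ^ 2 := by
        refine Finset.sum_le_sum fun j _ => ?_
        exact sq_le_sq.2 ((norm_le_pi_norm x.ofLp j).trans (le_abs_self _))
    _ = _ := by simp

theorem supNorm_nonneg {d : ℕ} (x : Vec d) : 0 ≤ supNorm x := norm_nonneg _

/-- The second conclusion controls the bias summed over `d` coordinates; the first keeps `δ²β ≤ 1`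
when `ε < 1`, so that the rotation angles exist. -/
theorem sq_step_mul_le {d : ℕ} (hd : 1 ≤ d) {β ε δ : ℝ} (hβ : 0 < β) (hε : 0 < ε) (hδ : 0 < δ)
    (h : δ ≤ 1 * (√ε / (√β * (d : ℝ) ^ (1 / 4 : ℝ)))) :
    δ ^ 2 * β ≤ ε ∧ d * (δ ^ 2 * β) ^ 2 ≤ ε ^ 2 := by
  have hd' : (1 : ℝ) ≤ d := by exact_mod_cast hd
  have hq1 : 1 ≤ (d : ℝ) ^ (1 / 4 : ℝ) := Real.one_le_rpow hd' (by norm_num)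
  have hq4 : ((d : ℝ) ^ (1 / 4 : ℝ)) ^ 4 = d := by
    rw [← Real.rpow_natCast, ← Real.rpow_mul (by positivity)]
    norm_num
  set q := (d : ℝ) ^ (1 / 4 : ℝ)
  have hb : 0 < √β := Real.sqrt_pos.2 hβ
  rw [one_mul, le_div_iff₀ (by positivity)] at h
  have h2 : (δ * (√β * q)) ^ 2 ≤ √ε ^ 2 := by gcongr
  rw [Real.sq_sqrt hε.le, mul_pow, mul_pow, Real.sq_sqrt hβ.le, ← mul_assoc] at h2
  have h0 : 0 < δ ^ 2 * β := by positivity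
  refine ⟨?_, ?_⟩
  · exact (le_mul_of_one_le_right h0.le (one_le_pow₀ hq1)).trans h2
  · calc d * (δ ^ 2 * β) ^ 2 = (δ ^ 2 * β * q ^ 2) ^ 2 := by rw [← hq4]; ring
      _ ≤ ε ^ 2 := by gcongr

theorem three_quarters_pow_le {a : ℝ} (ha : 0 < a) {K : ℕ} (hK : 800 * Real.log a ≤ K) :
    (3 / 4 : ℝ) ^ K ≤ (a ^ 200)⁻¹ := by
  have h1 : (3 / 4 : ℝ) ≤ Real.exp (-(1 / 4)) := by
    have := Real.one_sub_le_exp_neg (1 / 4 : ℝ)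
    linarith
  calc (3 / 4 : ℝ) ^ K ≤ Real.exp (-(1 / 4)) ^ K := by gcongr
    _ = Real.exp (-(K / 4)) := by
        rw [← Real.exp_nat_mul]
        congr 1
        ring
    _ ≤ Real.exp (-(200 * Real.log a)) := by
        gcongr
        linarith
    _ = (a ^ 200)⁻¹ := by
        rw [Real.exp_neg, mul_comm, Real.exp_mul, Real.exp_log ha]
        norm_cast

theorem tvDist_hmcKernel_pow_le {d : ℕ} (hd : 1 ≤ d) {α β : ℝ} (hα : 0 < α) (hαβ : α ≤ β)
    {B : Matrix (Fin d) (Fin d) ℝ} (hB : B.IsHermitian) (hlo : ∀ j, α ≤ hB.eigenvalues j)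
    (hhi : ∀ j, hB.eigenvalues j ≤ β) {ε : ℝ} (hε : 0 < ε) (x : Vec d) {K : ℕ} {δ : ℝ}
    (hδ : 0 < δ) (hK : 800 * Real.log (d * (β / α) * (√α * supNorm x + 1) / ε) ≤ K)
    (hstep : δ ≤ 1 * (√ε / (√β * (d : ℝ) ^ (1 / 4 : ℝ)))) :
    tvDist ((hmcKernel B α δ ^ K) x) (target B) ≤ ε := by
  have hβ : 0 < β := hα.trans_le hαβ
  have hpos (j : Fin d) : 0 < hB.eigenvalues j := hα.trans_le (hlo j)
  have hd' : (1 : ℝ) ≤ d := by exact_mod_cast hd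
  have hκ : 1 ≤ β / α := (one_le_div hα).2 hαβ
  have hS0 := supNorm_nonneg x
  obtain ⟨hδε, hδd⟩ := sq_step_mul_le hd hβ hε hδ hstep
  have := isMarkovKernel_hmcKernel hB hα hδ
  have := isMarkovKernel_pow (hmcKernel B α δ) K
  refine tvDist_le_of_forall fun A hA => ?_
  rcases le_or_gt 1 ε with hε1 | hε1
  · have : IsProbabilityMeasure (target B) := by
      rw [target_eq_basisGaussian hB hpos]
      infer_instance
    exact (abs_real_sub_real_le_one _ _ A).trans hε1
  have hδβ : δ ^ 2 * β ≤ 1 := hδε.trans hε1.le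
  have hu0 (j : Fin d) : 0 ≤ δ ^ 2 * hB.eigenvalues j / 4 := by
    have := hpos j
    positivity
  have hu1 (j : Fin d) : δ ^ 2 * hB.eigenvalues j / 4 ≤ δ ^ 2 * β / 4 := by
    gcongr
    exact hhi j
  have hu4 (j : Fin d) : δ ^ 2 * hB.eigenvalues j / 4 ≤ 1 / 4 := by linarith [hu1 j]
  have hy := sum_repr_sq_le hB.eigenvectorBasis x
  set S := supNorm x
  have hα' : √α ^ 2 = α := Real.sq_sqrt hα.le
  have hσ : 1 ≤ √α * S + 1 := by
    have := mul_nonneg (Real.sqrt_nonneg α) hS0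
    linarith
  have hdκ : 1 ≤ d * (β / α) := one_le_mul_of_one_le_of_one_le hd' hκ
  set M := d * (β / α) * (√α * S + 1) with hM
  have hM1 : 1 ≤ M := one_le_mul_of_one_le_of_one_le hdκ hσ
  refine abs_le_of_sq_le_sq ?_ hε.le
  -- When `M / ε` is close to `1` the logarithm is almost `0` and forces no more than `K ≥ 1`. Then
  -- `M` and `ε` are both near `1`, so `d = 1`, `β / α ≈ 1` and `√α S ≈ 0`, and one transition
  -- suffices.
  rcases le_or_gt (51 / 50) (M / ε) with hr | hr
  · have hb := sq_hmcKernel_pow_sub_target_le hB hα hlo hhi hδ hδβ x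
      (U := fun j => 2 * (δ ^ 2 * hB.eigenvalues j / 4) ^ 2)
      (w := fun j => 2 + hB.eigenvalues j * hB.eigenvectorBasis.repr x j ^ 2 / 2)
      (fun j => by positivity)
      (fun j => by have := hpos j; positivity)
      (fun j => by
        have := mul_nonneg (hpos j).le (sq_nonneg (hB.eigenvectorBasis.repr x j))
        have := sq_nonneg (δ ^ 2 * hB.eigenvalues j / 4)
        linarith)
      (fun j r hr => one_sub_gaussianAffinitySq_le _ (hpos j) (hu0 j) (hu4 j) hr) K hA
    refine hb.trans ?_
    rw [Finset.sum_add_distrib, ← Finset.mul_sum (a := (3 / 4 : ℝ) ^ K)]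
    have hUsum : ∑ j, 2 * (δ ^ 2 * hB.eigenvalues j / 4) ^ 2 ≤ ε ^ 2 / 8 := by
      calc ∑ j, 2 * (δ ^ 2 * hB.eigenvalues j / 4) ^ 2
          ≤ ∑ _j : Fin d, 2 * (δ ^ 2 * β / 4) ^ 2 := by
            gcongr with j
            · exact hu0 j
            · exact hhi j
        _ = d * (δ ^ 2 * β) ^ 2 / 8 := by
            simp only [Finset.sum_const, Finset.card_univ, Fintype.card_fin, nsmul_eq_mul]
            ring
        _ ≤ ε ^ 2 / 8 := by gcongr
    have hwsum : ∑ j, (2 + hB.eigenvalues j * hB.eigenvectorBasis.repr x j ^ 2 / 2)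
        ≤ 2 * M ^ 2 := by
      have h1 : ∑ j, (2 + hB.eigenvalues j * hB.eigenvectorBasis.repr x j ^ 2 / 2)
          ≤ 2 * d + β / 2 * (d * S ^ 2) := by
        calc ∑ j, (2 + hB.eigenvalues j * hB.eigenvectorBasis.repr x j ^ 2 / 2)
            ≤ ∑ j, (2 + β * hB.eigenvectorBasis.repr x j ^ 2 / 2) := by
              gcongr with j
              exact hhi j
          _ = 2 * d + β / 2 * ∑ j, hB.eigenvectorBasis.repr x j ^ 2 := by
              rw [Finset.sum_add_distrib, Finset.mul_sum]
              congr 1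
              · simp [mul_comm]
              · exact Finset.sum_congr rfl fun j _ => by ring
          _ ≤ _ := by gcongr
      have h2 : d * (β / α) * (√α * S + 1) ^ 2 ≤ M ^ 2 := by
        rw [hM, mul_pow]
        gcongr
        exact le_self_pow₀ hdκ (by norm_num)
      have h3 : d + β * (d * S ^ 2) ≤ d * (β / α) * (√α * S + 1) ^ 2 := by
        have h4 : α * S ^ 2 + 1 ≤ (√α * S + 1) ^ 2 := by
          have := mul_nonneg (Real.sqrt_nonneg α) hS0
          nlinarith
        calc d + β * (d * S ^ 2) ≤ d * (β / α) + d * (β / α) * (α * S ^ 2) := by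
              have h5 : d * (β / α) * (α * S ^ 2) = β * (d * S ^ 2) := by field_simp
              have h6 : (d : ℝ) ≤ d * (β / α) := le_mul_of_one_le_right (by positivity) hκ
              linarith
          _ = d * (β / α) * (α * S ^ 2 + 1) := by ring
          _ ≤ _ := by gcongr
      have : 0 ≤ β * (d * S ^ 2) := by positivity
      linarith
    have hp : (3 / 4 : ℝ) ^ K * (2 * M ^ 2) ≤ ε ^ 2 / 2 := by
      have hMε : 0 < M / ε := by linarith
      have h1 := three_quarters_pow_le hMε hK
      -- Of the power `200`, two factors cancel `M²` against `ε²`, and the other `198` supply the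
      -- constant `4`.
      have h2 : (4 : ℝ) ≤ (M / ε) ^ 198 :=
        calc (4 : ℝ) ≤ (51 / 50) ^ 198 := by norm_num
          _ ≤ _ := by gcongr
      have h3 : (M / ε) ^ 200 = (M / ε) ^ 198 * (M / ε) ^ 2 := by rw [← pow_add]
      calc (3 / 4 : ℝ) ^ K * (2 * M ^ 2) ≤ ((M / ε) ^ 200)⁻¹ * (2 * M ^ 2) := by gcongr
        _ ≤ (4 * (M / ε) ^ 2)⁻¹ * (2 * M ^ 2) := by
            rw [h3]
            gcongr
        _ = ε ^ 2 / 2 := by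
            field_simp
            norm_num
    have := mul_le_mul_of_nonneg_left hwsum (show (0 : ℝ) ≤ (3 / 4) ^ K by positivity)
    -- Bias and transient add up to at most `ε²/8 + ε²/2 ≤ ε²`.
    linarith [sq_nonneg ε]
  · rw [div_lt_iff₀ hε] at hr
    have hM2 : M < 51 / 50 := by linarith
    have hdM : (d : ℝ) ≤ M := by
      rw [hM, mul_assoc]
      exact le_mul_of_one_le_right (by positivity) (one_le_mul_of_one_le_of_one_le hκ hσ)
    have hd1 : d = 1 := by
      have : (d : ℝ) < 2 := by linarith
      have : d < 2 := by exact_mod_cast this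
      omega
    have hκM : β / α ≤ 51 / 50 := by
      have : β / α ≤ M := by
        rw [hM, mul_right_comm]
        exact le_mul_of_one_le_left (by positivity) (one_le_mul_of_one_le_of_one_le hd' hσ)
      linarith
    have hσM : √α * S ≤ 1 / 50 := by
      have : √α * S + 1 ≤ M := le_mul_of_one_le_left (by positivity) hdκ
      linarith
    have hK1 : 1 ≤ K := by
      have : 0 < Real.log (M / ε) := Real.log_pos ((one_lt_div hε).2 (by linarith))
      have : (0 : ℝ) < K := by linarith
      exact_mod_cast this
    have hly (j : Fin d) : hB.eigenvalues j * hB.eigenvectorBasis.repr x j ^ 2 ≤ 1 / 2 := by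
      have h1 : hB.eigenvectorBasis.repr x j ^ 2 ≤ S ^ 2 := by
        have := Finset.single_le_sum (f := fun j => hB.eigenvectorBasis.repr x j ^ 2)
          (fun j _ => sq_nonneg _) (Finset.mem_univ j)
        refine this.trans (hy.trans_eq ?_)
        rw [show (d : ℝ) = 1 by exact_mod_cast hd1, one_mul]
      calc hB.eigenvalues j * hB.eigenvectorBasis.repr x j ^ 2 ≤ β * S ^ 2 := by
            gcongr
            exact hhi j
        _ = β / α * (√α * S) ^ 2 := by
            rw [mul_pow, hα']
            field_simp
        _ ≤ 51 / 50 * (1 / 50) ^ 2 := by gcongr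
        _ ≤ 1 / 2 := by norm_num
    have hb := sq_hmcKernel_pow_sub_target_le hB hα hlo hhi hδ hδβ x
      (U := fun _ => 5 / 6) (w := fun _ => 1 / 6) (fun j => by norm_num) (fun j => by norm_num)
      (fun j => by norm_num)
      (fun j r hr => one_sub_gaussianAffinitySq_le_of_small (hpos j) (hu0 j) (hu4 j) hr (hly j))
      K hA
    refine hb.trans ?_
    rw [Finset.sum_const, Finset.card_univ, Fintype.card_fin, nsmul_eq_mul, hd1, Nat.cast_one,
      one_mul]
    have h34 : (3 / 4 : ℝ) ^ K ≤ 3 / 4 := pow_le_of_le_one (by norm_num) (by norm_num) (by omega)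
    have hε2 : 50 / 51 ≤ ε := by linarith
    -- Numerically, `5/6 + (3/4)(1/6) = 23/24 < (50/51)² ≤ ε²`.
    nlinarith

end UnadjustedHMC

end

open UnadjustedHMC
theorem mainTheorem4 :
    ∃ C C' C'' : ℝ, 0 < C ∧ 0 < C' ∧ C' ≤ 1 ∧ 0 < C'' ∧
      ∀ (d : ℕ) (_ : 1 ≤ d) (α β : ℝ) (_ : 0 < α) (_ : α ≤ β)
        (B : Matrix (Fin d) (Fin d) ℝ)
        (_ : (B - α • (1 : Matrix (Fin d) (Fin d) ℝ)).PosSemidef)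
        (_ : (β • (1 : Matrix (Fin d) (Fin d) ℝ) - B).PosSemidef)
        (ε : ℝ) (_ : 0 < ε) (x : Vec d) (K : ℕ) (δ : ℝ) (_ : 0 < δ)
        (_ : C * Real.log (d * (β / α) * (√α * supNorm x + 1) / ε) ≤ K)
        (_ : δ ≤ C' * (√ε / (√β * (d : ℝ) ^ (1 / 4 : ℝ)))),
        -- closeness in total variation of the `K`-step distribution to the target
        tvDist ((hmcKernel B α δ ^ K) x) (target B) ≤ ε ∧
        -- the algorithm with gradient oracle returns a sample from the `K`-step distribution
        (drawsLaw d α δ K).map (fun ξ => (hmcProg δ K ξ x).output (gradient (potential B)))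
          = (hmcKernel B α δ ^ K) x ∧
        -- and its number of gradient evaluations is bounded, for `δ` of the allowed order
        ∀ c : ℝ, 0 < c → c * (√ε / (√β * (d : ℝ) ^ (1 / 4 : ℝ))) ≤ δ →
          ∀ᵐ ξ ∂(drawsLaw d α δ K),
            ((hmcProg δ K ξ x).queries (gradient (potential B)) : ℝ)
              ≤ C'' / c * (√(β / α) * (d : ℝ) ^ (1 / 4 : ℝ) * K / √ε) := by
  have hpi := Real.pi_pos
  -- `800 = 4 · 200` comes from `(3/4)^K ≤ e^(-K/4)` and the power `200` in `three_quarters_pow_le`;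
  -- `20π` is two queries for each of at most `10π / (√α δ)` steps.
  refine ⟨800, 1, 20 * Real.pi, by norm_num, one_pos, le_rfl, by positivity, ?_⟩
  intro d hd α β hα hαβ B hlo hhi ε hε x K δ hδ hK hstep
  have hB : B.IsHermitian := by
    have h1 := hlo.isHermitian.add
      (Matrix.isHermitian_one.smul (IsSelfAdjoint.all α) (n := Fin d) (α := ℝ))
    simpa using h1
  refine ⟨tvDist_hmcKernel_pow_le hd hα hαβ hB (le_eigenvalues hB hlo) (eigenvalues_le hB hhi)
    hε x hδ hK hstep, map_output_hmcProg hB hα hδ K x, ?_⟩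
  intro c hc hcδ
  filter_upwards [ae_queries_hmcProg_le (gradient (potential B)) hα hδ K x] with ξ hξ
  refine hξ.trans ?_
  have hβ : 0 < β := hα.trans_le hαβ
  have hq : 0 < (d : ℝ) ^ (1 / 4 : ℝ) := Real.rpow_pos_of_pos (by exact_mod_cast hd) _
  have hsα : 0 < √α := Real.sqrt_pos.2 hα
  have hsβ : 0 < √β := Real.sqrt_pos.2 hβ
  have hsε : 0 < √ε := Real.sqrt_pos.2 hε
  rw [Real.sqrt_div hβ.le]
  calc (K : ℝ) * (2 * (10 * Real.pi / √α / δ))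
      ≤ K * (2 * (10 * Real.pi / √α / (c * (√ε / (√β * (d : ℝ) ^ (1 / 4 : ℝ)))))) := by gcongr
    _ = _ := by
        field_simp
        ring
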